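/- Let $\kappa:[0,\infty)\to[c_1,c_2]$, $0<c_1<c_2$, be locally Lipschitz. For $T,\ell_0>0$, data $(y_0,y_1)\in (C^{0,1}\times L^\infty)[0,\ell_0]$ and a boundary control $u\in C^{0,1}[0,T]$, a $C^{0,1}$-solution of the debonding problem is a pair $(\ell,y)$ with $\ell\in C^{0,1}[0,T]$ and $y\in C^{0,1}(\{0\le t\le T,\ 0\le x\le \ell(t)\})$ such that $$\partial_{tt}^2y-\partial_{xx}^2y=0\quad\text{in the sense of distributions in }\{0<t<T,\ 0<x<\ell(t)\},$$ $$y(t,0)=u(t),\quad y(t,\ell(t))=0\quad(0\le t\le T),\qquad y(0,x)=y_0(x)\quad (0\le x\le \ell_0),\qquad \partial_ty(0,x)=y_1(x)\quad\text{for a.e. }x\in[0,\ell_0],$$ and such that Griffith's criterion holds: $\ell(0)=\ell_0$ and, for a.e. $t\in(0,T)$, the one-sided derivative $\partial_xy(t,\ell(t))$ exists and, with $G(t)=\tfrac12(1-\ell'(t)^2)\,(\partial_xy(t,\ell(t)))^2$, $$\ell'(t)\ge0,\qquad G(t)\le\kappa(\ell(t)),\qquad \ell'(t)\,[G(t)-\kappa(\ell(t))]=0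 .$$ For given initial data put $f(s)=\tfrac12\int_0^{-s}(y_0'-y_1)(\sigma)\,d\sigma$ for $s\in[-\ell_0,0]$, let $\ell$ be the Lipschitz solution of $$\ell'(t)=\max\Big[\tfrac{2f'(t-\ell(t))^2-\kappa(\ell(t))}{2f'(t-\ell(t))^2+\kappa(\ell(t))},\,0\Big]\ \text{ for a.e. } t,\qquad \ell(0)=\ell_0,$$ up to the time $t_*>0$ at which $\ell(t_*)=t_*$, and put $\ell_*=\ell(t_*)$. (This initial branch of the front does not depend on $u$.) **Corollary ($C^{0,1}$-controllability, static final branch).** Let $\ell_0>0$ and $(y_0,y_1)\in(C^{0,1}\times L^\infty)[0,\ell_0]$ with $y_0(\ell_0)=0$. Let $T>0$, $\bar\ell_0>0$ and $(\bar y_0,\bar y_1)\in(C^{0,1}\times L^\infty)[0,\bar\ell_0]$ (for instance $\bar y_0\in C^1$, $\bar y_1\in C^0$) satisfy $$\bar\ell_0\ge\ell_*,\qquad T>2\bar\ell_0,\qquad \bar y_0(\bar\ell_0)=0,\qquad \|\bar y_1+\bar y_0'\|_{L^\infty[0,\bar\ell_0]}^2\le2\,\kappa(\bar\ell_0).$$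 Then there is a control $u\in C^{0,1}[0,T]$ for which the debonding problem has a $C^{0,1}$-solution on $[0,T]$, and every such solution $(\ell,y)$ satisfies $$\ell(T)=\bar\ell_0,\qquad y(T,\cdot)=\bar y_0\ \text{on }[0,\bar\ell_0],\qquad \partial_ty(T,x)=\bar y_1(x)\ \text{for a.e. }x\in[0,\bar\ell_0],$$ and moreover $\ell(t)=\bar\ell_0$ for all $t\in[T-\bar\ell_0,T]$. -/

import Mathlib

open Set MeasureTheory
open scoped ENNReal NNReal ContDiff

noncomputable section

namespace Debonding

/-- `g` is of class `C^{0,1}` on `[a, b]`. -/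
def LipschitzIcc (g : ℝ → ℝ) (a b : ℝ) : Prop :=
  ∃ K : ℝ≥0, LipschitzOnWith K g (Icc a b)

/-- The closed space-time region `{0 ≤ t ≤ T, 0 ≤ x ≤ ℓ(t)}`; points are pairs `(t, x)`. -/
def closedRegion (T : ℝ) (ℓ : ℝ → ℝ) : Set (ℝ × ℝ) :=
  {p | 0 ≤ p.1 ∧ p.1 ≤ T ∧ 0 ≤ p.2 ∧ p.2 ≤ ℓ p.1}

/-- The open space-time region `{0 < t < T, 0 < x < ℓ(t)}`. -/
def openRegion (T : ℝ) (ℓ : ℝ → ℝ) : Set (ℝ × ℝ) :=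
  {p | 0 < p.1 ∧ p.1 < T ∧ 0 < p.2 ∧ p.2 < ℓ p.1}

/-- The d'Alembertian `∂_t² φ - ∂_x² φ` of a smooth function `φ(t, x)`. -/
def dAlembertian (φ : ℝ × ℝ → ℝ) (p : ℝ × ℝ) : ℝ :=
  iteratedDeriv 2 (fun t => φ (t, p.2)) p.1 - iteratedDeriv 2 (fun x => φ (p.1, x)) p.2

/-- The wave equation `∂_t² y - ∂_x² y = 0` in the sense of distributions on
`{0 < t < T, 0 < x < ℓ(t)}`. -/
def WeakWave (T : ℝ) (ℓ : ℝ → ℝ) (y : ℝ → ℝ → ℝ) : Prop :=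
  ∀ φ : ℝ × ℝ → ℝ, ContDiff ℝ ∞ φ → HasCompactSupport φ → tsupport φ ⊆ openRegion T ℓ →
    ∫ p : ℝ × ℝ, y p.1 p.2 * dAlembertian φ p = 0

/-- The dynamic energy release rate `½ (1 - v²) p²` at speed `v`, where `p` is the value of `∂_x y`
at the front. -/
def energyReleaseRate (v p : ℝ) : ℝ := (1 / 2) * (1 - v ^ 2) * p ^ 2

/-- Griffith's criterion, for almost every time. The value of `∂_x y` at the front is the
one-sided derivative in `x` at `x = ℓ(t)`, whose existence for almost every `t` is required. -/
def Griffith (κ : ℝ → ℝ) (T : ℝ) (ℓ : ℝ → ℝ) (y : ℝ → ℝ → ℝ) : Prop :=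
  ∀ᵐ t ∂(volume.restrict (Icc 0 T)),
    ∃ p : ℝ, HasDerivWithinAt (fun x => y t x) p (Icc 0 (ℓ t)) (ℓ t) ∧
      0 ≤ deriv ℓ t ∧
      energyReleaseRate (deriv ℓ t) p ≤ κ (ℓ t) ∧
      deriv ℓ t * (energyReleaseRate (deriv ℓ t) p - κ (ℓ t)) = 0

/-- `(ℓ, y)` is a `C^{0,1}`-solution on `[0, T]` of the debonding problem with toughness `κ`,
initial data `(ℓ₀, y₀, y₁)` and boundary control `u`. -/
structure IsSolution (κ : ℝ → ℝ) (T ℓ₀ : ℝ) (y₀ y₁ u : ℝ → ℝ) (ℓ : ℝ → ℝ) (y : ℝ → ℝ → ℝ) :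
    Prop where
  front_lipschitz : LipschitzIcc ℓ 0 T
  lipschitz : ∃ K : ℝ≥0, LipschitzOnWith K (fun p : ℝ × ℝ => y p.1 p.2) (closedRegion T ℓ)
  wave : WeakWave T ℓ y
  boundary_left : ∀ t ∈ Icc 0 T, y t 0 = u t
  boundary_front : ∀ t ∈ Icc 0 T, y t (ℓ t) = 0
  initial_position : ∀ x ∈ Icc 0 ℓ₀, y 0 x = y₀ x
  initial_velocity : ∀ᵐ x ∂(volume.restrict (Icc 0 ℓ₀)),
    HasDerivWithinAt (fun t => y t x) (y₁ x) (Icc 0 T) 0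
  front_initial : ℓ 0 = ℓ₀
  griffith : Griffith κ T ℓ y

/-- The function `f(s) = ½ ∫₀^{-s} (y₀' - y₁)` on `[-ℓ₀, 0]`: up to a constant, the part of the
solution travelling to the right, as determined by the initial data. -/
def initialProfile (y₀ y₁ : ℝ → ℝ) (s : ℝ) : ℝ :=
  (1 / 2) * ∫ σ in (0 : ℝ)..(-s), (deriv y₀ σ - y₁ σ)

/-- `ℓ` on `[0, tS]` is the initial branch of the front: it solves
`ℓ' = max[(2 f'(t - ℓ)² - κ(ℓ)) / (2 f'(t - ℓ)² + κ(ℓ)), 0]` almost everywhere, with `ℓ(0) = ℓ₀`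
and `f` the profile of the initial data, up to the time `tS` at which `ℓ(tS) = tS`. -/
structure IsInitialBranch (κ : ℝ → ℝ) (ℓ₀ : ℝ) (y₀ y₁ : ℝ → ℝ) (tS : ℝ) (ℓ : ℝ → ℝ) :
    Prop where
  pos : 0 < tS
  lipschitz : LipschitzIcc ℓ 0 tS
  start : ℓ 0 = ℓ₀
  evolution : ∀ᵐ t ∂(volume.restrict (Icc 0 tS)),
    deriv ℓ t =
      max ((2 * deriv (initialProfile y₀ y₁) (t - ℓ t) ^ 2 - κ (ℓ t)) /
        (2 * deriv (initialProfile y₀ y₁) (t - ℓ t) ^ 2 + κ (ℓ t))) 0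
  finish : ℓ tS = tS

/-- The position `ℓ_*` of the front at the end of the initial branch. The set is a singleton
for admissible data, since the evolution determines the branch. -/
def initialFront (κ : ℝ → ℝ) (ℓ₀ : ℝ) (y₀ y₁ : ℝ → ℝ) : ℝ :=
  sInf {lS : ℝ | ∃ (tS : ℝ) (ℓ : ℝ → ℝ), IsInitialBranch κ ℓ₀ y₀ y₁ tS ℓ ∧ ℓ tS = lS}

end Debonding

end

noncomputable section

namespace Debonding

/-! ### Absolutely continuous functions and null sets on the line -/

/-! By d'Alembert, a solution is `y = f(t - x) + g(t + x)`, and `y = 0` on the front means `g(t + ℓ)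
= -f(t - ℓ)`. Written in the characteristic variable `s = t - ℓ(t)`, Griffith's criterion becomes
the ODE `dℓ/ds = max(f'(s)²/κ(ℓ) - 1/2, 0)`, which involves `f` alone. For `s < 0` the profile `f`
is fixed by the initial data; for `s > 0` it is free, since `u = f + g` can be read off afterwards.
So control amounts to choosing `f` on `[0, T]`, with three tasks in succession.

On `[0, T - 2ℓbar]` the profile pushes the front from `ℓ_*` to `ℓbar` at a constant rate in `s`
(`exists_push`). On `[T - 2ℓbar, T - ℓbar]` one takes `f' = -(ybar₁ + ybar₀')/2`: the size condition
says exactly `f'² ≤ κ(ℓbar)/2`, so the front rests, and the reflected wave is the left-going part of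
the terminal data. On `[T - ℓbar, T]` one takes `f' = (ybar₁ - ybar₀')/2`, the right-going part,
whose characteristics do not reach the front before time `T`. This is
`exists_steering_frontProfile`; solving the ODE and reflecting then give a solution
(`Profile.exists_solution`).

Every other solution for the same control must coincide with this one (`Profile.unique`). A
Lipschitz weak solution satisfies the parallelogram identity up to the boundary
(`WeakWave.parallelogram`). Hence it equals `f(t - x)` plus a function of `t + x`, first for `t - x
≤ 0` by the initial data, then strip by strip of width `ℓ₀` by the boundary values. Such a splitting
forces the flow rule on the front (`hasDerivWithinAt_front_relation`, `flow_of_griffith`), and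
Grönwall's inequality identifies the front (`front_eq_of_flow`). The same uniqueness argument
identifies `ℓ_*` (`FrontProfile.initialFront_eq`). -/

theorem LipschitzIcc.absolutelyContinuous {g : ℝ → ℝ} {a b : ℝ} (hab : a ≤ b)
    (hg : LipschitzIcc g a b) : AbsolutelyContinuousOnInterval g a b := by
  obtain ⟨K, hK⟩ := hg
  apply LipschitzOnWith.absolutelyContinuousOnInterval (K := K)
  rwa [uIcc_of_le hab]

theorem sub_eq_integral_of_ae_hasDerivAt {g g' : ℝ → ℝ} {a b : ℝ} (hab : a ≤ b)
    (hg : AbsolutelyContinuousOnInterval g a b)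
    (h : ∀ᵐ t, t ∈ Ioo a b → HasDerivAt g (g' t) t) : g b - g a = ∫ t in a..b, g' t := by
  rw [← hg.integral_deriv_eq_sub]
  apply intervalIntegral.integral_congr_ae
  have hb : ∀ᵐ t : ℝ, t ≠ b := by simp [ae_iff]
  filter_upwards [h, hb] with t ht htb htm
  rw [uIoc_of_le hab] at htm
  exact (ht ⟨htm.1, lt_of_le_of_ne htm.2 htb⟩).deriv

theorem sub_nonneg_of_ae_hasDerivAt {g g' : ℝ → ℝ} {a b : ℝ} (hab : a ≤ b)
    (hg : AbsolutelyContinuousOnInterval g a b)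
    (h : ∀ᵐ t, t ∈ Ioo a b → HasDerivAt g (g' t) t ∧ 0 ≤ g' t) : 0 ≤ g b - g a := by
  have h0 : ∀ᵐ t : ℝ, t ∈ Ioo a b → HasDerivAt g (g' t) t := by
    filter_upwards [h] with t ht htm using (ht htm).1
  rw [sub_eq_integral_of_ae_hasDerivAt hab hg h0]
  apply intervalIntegral.integral_nonneg_of_ae_restrict hab
  have hb : ∀ᵐ t : ℝ, t ≠ b := by simp [ae_iff]
  have ha : ∀ᵐ t : ℝ, t ≠ a := by simp [ae_iff]
  rw [Filter.EventuallyLE, ae_restrict_iff' measurableSet_Icc]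
  filter_upwards [h, hb, ha] with t ht htb hta htm
  exact (ht ⟨lt_of_le_of_ne htm.1 hta.symm, lt_of_le_of_ne htm.2 htb⟩).2

/-- Grönwall's inequality for a.e. differential inequalities, in the form of a uniqueness
statement. -/
theorem eq_zero_of_ae_abs_deriv_le {g g' : ℝ → ℝ} {a b C : ℝ} (hab : a ≤ b)
    (hg : AbsolutelyContinuousOnInterval g a b) (h0 : g a = 0)
    (h : ∀ᵐ t, t ∈ Ioo a b → HasDerivAt g (g' t) t ∧ |g' t| ≤ C * |g t|) : g b = 0 := by
  have hE : AbsolutelyContinuousOnInterval (fun t => Real.exp (-(2 * C) * t)) a b := by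
    apply ContDiffOn.absolutelyContinuousOnInterval
    exact (by fun_prop : ContDiff ℝ 1 fun t : ℝ => Real.exp (-(2 * C) * t)).contDiffOn
  -- Since `g g' ≤ C g²`, the damped square `g² exp(-2Ct)` does not increase; it starts at zero.
  have key := sub_nonneg_of_ae_hasDerivAt
    (g := fun t => -(g t * g t * Real.exp (-(2 * C) * t)))
    (g' := fun t => (2 * C * g t * g t - 2 * g t * g' t) * Real.exp (-(2 * C) * t)) hab
    ((hg.mul hg).mul hE).neg ?_
  · have : g b * g b * Real.exp (-(2 * C) * b) ≤ 0 := by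
      simp only [h0] at key
      linarith
    have h2 : g b * g b ≤ 0 := by
      by_contra hc
      push Not at hc
      have := mul_pos hc (Real.exp_pos (-(2 * C) * b))
      linarith
    have := mul_self_nonneg (g b)
    exact mul_self_eq_zero.1 (le_antisymm h2 this)
  · filter_upwards [h] with t ht htm
    obtain ⟨h1, h2⟩ := ht htm
    constructor
    · have hexp : HasDerivAt (fun t : ℝ => Real.exp (-(2 * C) * t))
          (Real.exp (-(2 * C) * t) * (-(2 * C))) t := by
        have := ((hasDerivAt_id t).const_mul (-(2 * C))).exp
        simpa using this
      have := ((h1.fun_mul h1).fun_mul hexp).fun_neg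
      exact this.congr_deriv (by ring)
    · apply mul_nonneg _ (Real.exp_pos _).le
      have h3 : g t * g' t ≤ |g t| * (C * |g t|) :=
        (le_abs_self _).trans (by rw [abs_mul]; exact mul_le_mul_of_nonneg_left h2 (abs_nonneg _))
      have h4 : |g t| * (C * |g t|) = C * (g t * g t) := by
        rw [← abs_mul_abs_self (g t)]; ring
      linarith

theorem LipschitzIcc.ae_differentiableAt {g : ℝ → ℝ} {a b : ℝ} (hg : LipschitzIcc g a b) :
    ∀ᵐ t, t ∈ Ioo a b → DifferentiableAt ℝ g t := by
  obtain ⟨K, hK⟩ := hg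
  filter_upwards [hK.ae_differentiableWithinAt_of_mem_real] with t ht htm
  exact (ht (Ioo_subset_Icc_self htm)).differentiableAt (Icc_mem_nhds htm.1 htm.2)

/-- Maps that do not contract distances by more than a constant factor pull null sets back to
null sets. -/
theorem ae_comp_of_expanding {A : Set ℝ} {φ : ℝ → ℝ} {C : ℝ≥0} {P : ℝ → Prop}
    (hφ : ∀ t ∈ A, ∀ t' ∈ A, |t - t'| ≤ C * |φ t - φ t'|) (hP : ∀ᵐ s, P s) :
    ∀ᵐ t, t ∈ A → P (φ t) := by
  have hinj : InjOn φ A := by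
    intro t ht t' ht' h
    have := hφ t ht t' ht'
    rw [h, sub_self, abs_zero, mul_zero] at this
    exact sub_eq_zero.1 (abs_eq_zero.1 (le_antisymm this (abs_nonneg _)))
  set g := Function.invFunOn φ A
  have hg : ∀ t ∈ A, g (φ t) = t := fun t ht => hinj.leftInvOn_invFunOn ht
  have hL : LipschitzOnWith C g (φ '' A ∩ {s | ¬ P s}) := by
    apply LipschitzOnWith.of_dist_le_mul
    rintro _ ⟨⟨t, ht, rfl⟩, -⟩ _ ⟨⟨t', ht', rfl⟩, -⟩
    rw [hg t ht, hg t' ht']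
    exact hφ t ht t' ht'
  -- On the line, Lebesgue measure is the one-dimensional Hausdorff measure, and the Lipschitz
  -- inverse `g` maps null sets to null sets. No measurability of `A` or of `φ` is needed.
  have h1 := hL.hausdorffMeasure_image_le (d := 1) zero_le_one
  rw [hausdorffMeasure_real] at h1
  have h2 : volume (φ '' A ∩ {s | ¬ P s}) = 0 :=
    measure_mono_null inter_subset_right (ae_iff.1 hP)
  rw [h2, mul_zero] at h1
  rw [ae_iff]
  refine measure_mono_null ?_ (le_antisymm h1 zero_le)
  intro t ht
  simp only [mem_ofPred_eq, Classical.not_imp] at ht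
  exact ⟨φ t, ⟨⟨t, ht.1, rfl⟩, ht.2⟩, hg t ht.1⟩

theorem lipschitzIcc_of_ae_deriv {g : ℝ → ℝ} {a b q : ℝ} (hg : LipschitzIcc g a b)
    (hd : ∀ᵐ t, t ∈ Ioo a b → 0 ≤ deriv g t ∧ deriv g t ≤ q) :
    ∀ s ∈ Icc a b, ∀ t ∈ Icc a b, s ≤ t → g s ≤ g t ∧ g t - g s ≤ q * (t - s) := by
  intro s hs t ht hst
  have hg' : LipschitzIcc g s t := by
    obtain ⟨K, hK⟩ := hg
    exact ⟨K, hK.mono (Icc_subset_Icc hs.1 ht.2)⟩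
  have hsub : Ioo s t ⊆ Ioo a b := Ioo_subset_Ioo hs.1 ht.2
  constructor
  · have := sub_nonneg_of_ae_hasDerivAt (g' := deriv g) hst (hg'.absolutelyContinuous hst) (by
      filter_upwards [hd, hg.ae_differentiableAt] with r hr hr' hrm
      exact ⟨(hr' (hsub hrm)).hasDerivAt, (hr (hsub hrm)).1⟩)
    linarith
  · have hA : AbsolutelyContinuousOnInterval (fun r => q * r - g r) s t := by
      apply LipschitzIcc.absolutelyContinuous hst
      obtain ⟨K, hK⟩ := hg'
      refine ⟨‖q‖₊ + K, ?_⟩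
      have h1 : LipschitzWith ‖q‖₊ fun r : ℝ => q * r := by
        apply LipschitzWith.of_dist_le_mul
        intro x y
        simp [Real.dist_eq, ← mul_sub, abs_mul]
      exact h1.lipschitzOnWith.sub hK
    have := sub_nonneg_of_ae_hasDerivAt (g' := fun r => q - deriv g r) hst hA (by
      filter_upwards [hd, hg.ae_differentiableAt] with r hr hr' hrm
      refine ⟨?_, sub_nonneg.2 (hr (hsub hrm)).2⟩
      have := ((hasDerivAt_id r).const_mul q).fun_sub (hr' (hsub hrm)).hasDerivAt
      simpa using this)
    linarith

/-! ### Clamping to an interval -/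

/-- The projection of the line onto `[a, b]`. -/
def clamp (a b x : ℝ) : ℝ := max a (min b x)

theorem clamp_of_mem {a b x : ℝ} (h : x ∈ Icc a b) : clamp a b x = x := by
  simp [clamp, h.1, h.2]

theorem clamp_of_le {a b x : ℝ} (hab : a ≤ b) (h : x ≤ a) : clamp a b x = a := by
  simp [clamp, h, h.trans hab]

theorem clamp_of_ge {a b x : ℝ} (hab : a ≤ b) (h : b ≤ x) : clamp a b x = b := by
  simp [clamp, h, hab]

theorem clamp_mem {a b : ℝ} (hab : a ≤ b) (x : ℝ) : clamp a b x ∈ Icc a b := by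
  simp [clamp, hab]

theorem lipschitzWith_clamp (a b : ℝ) : LipschitzWith 1 (clamp a b) := by
  exact (LipschitzWith.id.const_min b).const_max a

theorem monotone_clamp (a b : ℝ) : Monotone (clamp a b) := fun _ _ h =>
  max_le_max le_rfl (min_le_min le_rfl h)

theorem LipschitzIcc.comp_clamp {g : ℝ → ℝ} {a b : ℝ} (hab : a ≤ b) (hg : LipschitzIcc g a b) :
    ∃ K : ℝ≥0, LipschitzWith K fun x => g (clamp a b x) := by
  obtain ⟨K, hK⟩ := hg
  refine ⟨K, ?_⟩
  apply LipschitzWith.of_dist_le_mul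
  intro x y
  refine (hK.dist_le_mul _ (clamp_mem hab x) _ (clamp_mem hab y)).trans ?_
  gcongr
  simpa using (lipschitzWith_clamp a b).dist_le_mul x y

/-! ### Primitives of bounded functions -/

theorem exists_bound_of_memLp_top {g : ℝ → ℝ} {s : Set ℝ}
    (hg : MemLp g ∞ (volume.restrict s)) : ∃ C : ℝ, 0 ≤ C ∧ ∀ᵐ x ∂(volume.restrict s), |g x| ≤ C := by
  refine ⟨(eLpNorm g ∞ (volume.restrict s)).toReal, ENNReal.toReal_nonneg, ?_⟩
  filter_upwards [ae_le_eLpNormEssSup (f := g) (μ := volume.restrict s)] with x hx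
  rw [eLpNorm_exponent_top, ← Real.norm_eq_abs, ← toReal_enorm]
  refine ENNReal.toReal_mono ?_ hx
  rw [← eLpNorm_exponent_top]
  exact hg.2.ne

theorem intervalIntegrable_of_memLp_top {g : ℝ → ℝ} {a b c d : ℝ}
    (hg : MemLp g ∞ (volume.restrict (Icc a b))) (hc : c ∈ Icc a b) (hd : d ∈ Icc a b) :
    IntervalIntegrable g volume c d := by
  have h1 : IntegrableOn g (Icc a b) := hg.integrable le_top
  exact (h1.mono_set (uIcc_subset_Icc hc hd)).intervalIntegrable

theorem lipschitzIcc_primitive {g : ℝ → ℝ} {a b : ℝ}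
    (hg : MemLp g ∞ (volume.restrict (Icc a b))) :
    LipschitzIcc (fun x => ∫ r in a..x, g r) a b := by
  obtain ⟨C, hC, hb⟩ := exists_bound_of_memLp_top hg
  refine ⟨⟨C, hC⟩, LipschitzOnWith.of_dist_le_mul ?_⟩
  intro x hx y hy
  have ha : a ∈ Icc a b := ⟨le_rfl, hx.1.trans hx.2⟩
  rw [dist_eq_norm, intervalIntegral.integral_interval_sub_left
    (intervalIntegrable_of_memLp_top hg ha hx) (intervalIntegrable_of_memLp_top hg ha hy)]
  rw [ae_restrict_iff' measurableSet_Icc] at hb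
  rw [Real.dist_eq]
  apply intervalIntegral.norm_integral_le_of_norm_le_const_ae
  filter_upwards [hb] with r hr hrm
  exact hr (uIcc_subset_Icc hy hx (uIoc_subset_uIcc hrm))

theorem ae_hasDerivAt_primitive {g : ℝ → ℝ} {a b : ℝ} (hab : a ≤ b)
    (hg : MemLp g ∞ (volume.restrict (Icc a b))) :
    ∀ᵐ x, x ∈ Ioo a b → HasDerivAt (fun x => ∫ r in a..x, g r) (g x) x := by
  have := (intervalIntegrable_of_memLp_top hg (left_mem_Icc.2 hab)
    (right_mem_Icc.2 hab)).ae_hasDerivAt_integral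
  filter_upwards [this] with x hx hxm
  refine hx ?_ a ?_
  · rw [uIcc_of_le hab]
    exact Ioo_subset_Icc_self hxm
  · simp

/-! ### Carathéodory differential equations -/

theorem intervalIntegrable_of_abs_le {g : ℝ → ℝ} {B : ℝ} (hg : Measurable g)
    (hB : ∀ s, |g s| ≤ B) (a b : ℝ) : IntervalIntegrable g volume a b :=
  (intervalIntegrable_const (c := B)).mono_fun' hg.aestronglyMeasurable
    (Filter.Eventually.of_forall hB)

theorem integral_mul_exp_le {K a s : ℝ} :
    ∫ σ in a..s, K * Real.exp (2 * K * (σ - a)) ≤ 1 / 2 * Real.exp (2 * K * (s - a)) := by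
  have h : ∀ σ ∈ uIcc a s, HasDerivAt (fun σ => 1 / 2 * Real.exp (2 * K * (σ - a)))
      (K * Real.exp (2 * K * (σ - a))) σ := by
    intro σ _
    have h1 : HasDerivAt (fun σ : ℝ => 2 * K * (σ - a)) (2 * K) σ := by
      simpa using ((hasDerivAt_id σ).sub_const a).const_mul (2 * K)
    exact (h1.exp.const_mul (1 / 2)).congr_deriv (by ring)
  rw [intervalIntegral.integral_eq_sub_of_hasDerivAt h (by
    apply Continuous.intervalIntegrable; fun_prop)]
  simp

/-- Banach's fixed point theorem for the integral equation, in the sup norm weighted by `exp(-2K(s -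
a))`: by `integral_mul_exp_le` the contraction factor is `1/2` on the whole interval, so no
continuation of local solutions is needed. `H` need only be measurable in `s`, as `f'` will be. -/
theorem exists_caratheodory {H : ℝ → ℝ → ℝ} {K : ℝ≥0} {B : ℝ}
    (hm : Measurable (Function.uncurry H)) (hB : ∀ s x, |H s x| ≤ B)
    (hK : ∀ s, LipschitzWith K (H s)) {a b : ℝ} (hab : a ≤ b) (x₀ : ℝ) :
    ∃ w : ℝ → ℝ, Continuous w ∧ ∀ s ∈ Icc a b, w s = x₀ + ∫ σ in a..s, H σ (w σ) := by
  let E : ℝ → ℝ := fun s => Real.exp (2 * K * (s - a))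
  have hEc : Continuous E := by fun_prop
  have hEpos : ∀ s, 0 < E s := fun s => Real.exp_pos _
  let ext : C(Icc a b, ℝ) → ℝ → ℝ := fun v s => E s * v (projIcc a b hab s)
  have hext : ∀ v, Continuous (ext v) := fun v =>
    hEc.mul (v.continuous.comp continuous_projIcc)
  have hmeas : ∀ v, Measurable fun σ => H σ (ext v σ) := fun v =>
    hm.comp (measurable_id.prodMk (hext v).measurable)
  have hint : ∀ v c d, IntervalIntegrable (fun σ => H σ (ext v σ)) volume c d := fun v c d =>
    intervalIntegrable_of_abs_le (hmeas v) (fun s => hB s _) c d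
  -- The weight is absorbed in the unknown: the fixed point is the solution divided by `E`, so the
  -- plain sup norm applies.
  let Φ : C(Icc a b, ℝ) → C(Icc a b, ℝ) := fun v =>
    ⟨fun s => (E s)⁻¹ * (x₀ + ∫ σ in a..s, H σ (ext v σ)), by
      have h1 : Continuous fun s => ∫ σ in a..s, H σ (ext v σ) :=
        intervalIntegral.continuous_primitive (hint v) a
      have h2 : Continuous fun s => (E s)⁻¹ * (x₀ + ∫ σ in a..s, H σ (ext v σ)) :=
        (hEc.inv₀ fun s => (hEpos s).ne').mul (continuous_const.add h1)
      exact h2.comp continuous_subtype_val⟩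
  have hΦ : ContractingWith (1 / 2) Φ := by
    refine ⟨by norm_num [← NNReal.coe_lt_coe], LipschitzWith.of_dist_le_mul fun v w => ?_⟩
    rw [ContinuousMap.dist_le (by positivity)]
    rintro ⟨s, hs⟩
    have hd : |∫ σ in a..s, (H σ (ext v σ) - H σ (ext w σ))| ≤ 1 / 2 * E s * dist v w := by
      calc |∫ σ in a..s, (H σ (ext v σ) - H σ (ext w σ))|
          ≤ ∫ σ in a..s, (K * E σ) * dist v w := by
            rw [← Real.norm_eq_abs]
            apply intervalIntegral.norm_integral_le_of_norm_le hs.1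
            · refine Filter.Eventually.of_forall fun σ _ => ?_
              have h1 := (hK σ).dist_le_mul (ext v σ) (ext w σ)
              rw [Real.dist_eq] at h1
              refine h1.trans ?_
              have h2 : dist (ext v σ) (ext w σ) ≤ E σ * dist v w := by
                simp only [ext, Real.dist_eq, ← mul_sub, abs_mul, abs_of_pos (hEpos σ)]
                refine mul_le_mul_of_nonneg_left ?_ (hEpos σ).le
                rw [← Real.dist_eq]
                exact ContinuousMap.dist_apply_le_dist _
              rw [mul_assoc]
              exact mul_le_mul_of_nonneg_left h2 K.2
            · apply Continuous.intervalIntegrable; fun_prop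
        _ = (∫ σ in a..s, K * E σ) * dist v w := by
            rw [intervalIntegral.integral_mul_const]
        _ ≤ _ := mul_le_mul_of_nonneg_right integral_mul_exp_le dist_nonneg
    have he : dist (Φ v ⟨s, hs⟩) (Φ w ⟨s, hs⟩) =
        (E s)⁻¹ * |∫ σ in a..s, (H σ (ext v σ) - H σ (ext w σ))| := by
      rw [intervalIntegral.integral_sub (hint v _ _) (hint w _ _)]
      simp only [Φ, ContinuousMap.coe_mk, Real.dist_eq, ← mul_sub, abs_mul,
        abs_of_pos (inv_pos.2 (hEpos s))]
      congr 2
      ring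
    rw [he]
    calc _ ≤ (E s)⁻¹ * (1 / 2 * E s * dist v w) :=
          mul_le_mul_of_nonneg_left hd (inv_pos.2 (hEpos s)).le
      _ = _ := by
          have := (hEpos s).ne'
          push_cast
          field_simp
  obtain ⟨v, hv⟩ : ∃ v, Φ v = v := ⟨_, hΦ.fixedPoint_isFixedPt⟩
  refine ⟨ext v, hext v, fun s hs => ?_⟩
  have h1 : v ⟨s, hs⟩ = (E s)⁻¹ * (x₀ + ∫ σ in a..s, H σ (ext v σ)) := by
    conv_lhs => rw [← hv]
    rfl
  have h2 : ext v s = E s * v ⟨s, hs⟩ := by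
    simp only [ext, projIcc_of_mem hab hs]
  rw [h2, h1, mul_inv_cancel_left₀ (hEpos s).ne']

/-! ### Travelling waves are weak solutions -/

theorem fderiv_fderiv_apply {φ : ℝ × ℝ → ℝ} (hφ : ContDiff ℝ ∞ φ) (p v w : ℝ × ℝ) :
    fderiv ℝ (fun q => fderiv ℝ φ q v) p w = fderiv ℝ (fderiv ℝ φ) p w v := by
  have h1 : DifferentiableAt ℝ (fderiv ℝ φ) p :=
    ((hφ.fderiv_right (m := ∞) (by simp)).differentiable (by simp)) p
  rw [fderiv_clm_apply h1 (differentiableAt_const v)]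
  simp

theorem hasDerivAt_fderiv_apply_line {φ : ℝ × ℝ → ℝ} (hφ : ContDiff ℝ ∞ φ) (v : ℝ × ℝ)
    {γ : ℝ → ℝ × ℝ} {w : ℝ × ℝ} {x : ℝ} (hγ : HasDerivAt γ w x) :
    HasDerivAt (fun r => fderiv ℝ φ (γ r) v) (fderiv ℝ (fderiv ℝ φ) (γ x) w v) x := by
  rw [← fderiv_fderiv_apply hφ]
  have h1 : ContDiff ℝ ∞ fun q => fderiv ℝ φ q v :=
    (hφ.fderiv_right (m := ∞) (by simp)).clm_apply contDiff_const
  exact ((h1.differentiable (by simp)) (γ x)).hasFDerivAt.comp_hasDerivAt x hγ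

theorem dAlembertian_eq {φ : ℝ × ℝ → ℝ} (hφ : ContDiff ℝ ∞ φ) (p : ℝ × ℝ) :
    dAlembertian φ p = fderiv ℝ (fderiv ℝ φ) p (1, 0) (1, 0) -
      fderiv ℝ (fderiv ℝ φ) p (0, 1) (0, 1) := by
  have h1 : ∀ x t : ℝ, HasDerivAt (fun t : ℝ => (t, x)) ((1 : ℝ), (0 : ℝ)) t := fun x t =>
    (hasDerivAt_id t).prodMk (hasDerivAt_const t x)
  have h2 : ∀ t x : ℝ, HasDerivAt (fun x : ℝ => (t, x)) ((0 : ℝ), (1 : ℝ)) x := fun t x =>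
    (hasDerivAt_const x t).prodMk (hasDerivAt_id x)
  have hd : Differentiable ℝ φ := hφ.differentiable (by simp)
  have h3 : deriv (fun t => φ (t, p.2)) = fun t => fderiv ℝ φ (t, p.2) (1, 0) := by
    funext t
    exact ((hd _).hasFDerivAt.comp_hasDerivAt t (h1 p.2 t)).deriv
  have h4 : deriv (fun x => φ (p.1, x)) = fun x => fderiv ℝ φ (p.1, x) (0, 1) := by
    funext x
    exact ((hd _).hasFDerivAt.comp_hasDerivAt x (h2 p.1 x)).deriv
  rw [dAlembertian, iteratedDeriv_succ, iteratedDeriv_one, iteratedDeriv_succ, iteratedDeriv_one,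
    h3, h4, (hasDerivAt_fderiv_apply_line hφ (1, 0) (h1 p.2 p.1)).deriv,
    (hasDerivAt_fderiv_apply_line hφ (0, 1) (h2 p.1 p.2)).deriv]

theorem continuous_dAlembertian {φ : ℝ × ℝ → ℝ} (hφ : ContDiff ℝ ∞ φ) :
    Continuous (dAlembertian φ) := by
  have h1 : Continuous (fderiv ℝ (fderiv ℝ φ)) :=
    ((hφ.fderiv_right (m := ∞) (by simp)).fderiv_right (m := ∞) (by simp)).continuous
  rw [funext (dAlembertian_eq hφ)]
  fun_prop

theorem dAlembertian_eq_zero {φ : ℝ × ℝ → ℝ} (hφ : ContDiff ℝ ∞ φ) {p : ℝ × ℝ}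
    (hp : p ∉ tsupport φ) : dAlembertian φ p = 0 := by
  have h : fderiv ℝ (fderiv ℝ φ) p = 0 := image_eq_zero_of_notMem_tsupport fun h =>
    hp (tsupport_fderiv_subset ℝ (tsupport_fderiv_subset ℝ h))
  simp [dAlembertian_eq hφ, h]

/-- Along the direction `(c, 1)` with `c² = 1`, the function `c ∂_tφ - ∂_xφ` has derivative `∂_t²φ -
∂_x²φ`, because the mixed derivatives cancel. It has compact support on the line. -/
theorem integral_dAlembertian_line {φ : ℝ × ℝ → ℝ} (hφ : ContDiff ℝ ∞ φ)
    (hc : HasCompactSupport φ) {c : ℝ} (hc1 : c * c = 1) (t : ℝ) :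
    ∫ x, dAlembertian φ (t + c * x, x) = 0 := by
  have hγ : ∀ x, HasDerivAt (fun x : ℝ => (t + c * x, x)) (c, (1 : ℝ)) x := fun x => by
    have h1 : HasDerivAt (fun x : ℝ => t + c * x) c x := by
      simpa using ((hasDerivAt_id x).const_mul c).const_add t
    exact h1.prodMk (hasDerivAt_id x)
  have hK : IsCompact (Prod.snd '' tsupport φ) := hc.isCompact.image continuous_snd
  have hKn : ∀ x ∉ Prod.snd '' tsupport φ, (t + c * x, x) ∉ tsupport φ := fun x hx h =>
    hx ⟨_, h, rfl⟩
  have hfd : Continuous (fderiv ℝ φ) := (hφ.fderiv_right (m := ∞) (by simp)).continuous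
  apply integral_eq_zero_of_hasDerivAt_of_integrable
    (f := fun x => c * fderiv ℝ φ (t + c * x, x) (1, 0) - fderiv ℝ φ (t + c * x, x) (0, 1))
  · intro x
    refine (((hasDerivAt_fderiv_apply_line hφ (1, 0) (hγ x)).const_mul c).fun_sub
      (hasDerivAt_fderiv_apply_line hφ (0, 1) (hγ x))).congr_deriv ?_
    rw [dAlembertian_eq hφ]
    have hs : IsSymmSndFDerivAt ℝ φ (t + c * x, x) :=
      hφ.contDiffAt.isSymmSndFDerivAt (by
        simpa using (mod_cast le_top : ((2 : ℕ∞) : WithTop ℕ∞) ≤ ((⊤ : ℕ∞) : WithTop ℕ∞)))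
    have hv : ((c, 1) : ℝ × ℝ) = c • ((1, 0) : ℝ × ℝ) + (0, 1) := by simp
    rw [hv]
    simp only [map_add, map_smul, add_apply, smul_apply,
      smul_eq_mul]
    rw [hs.eq (0, 1) (1, 0)]
    linear_combination fderiv ℝ (fderiv ℝ φ) (t + c * x, x) (1, 0) (1, 0) * hc1
  · apply Continuous.integrable_of_hasCompactSupport
    · exact (continuous_dAlembertian hφ).comp (by fun_prop)
    · exact HasCompactSupport.intro hK fun x hx => dAlembertian_eq_zero hφ (hKn x hx)
  · apply Continuous.integrable_of_hasCompactSupport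
    · have : Continuous fun x : ℝ => fderiv ℝ φ (t + c * x, x) := hfd.comp (by fun_prop)
      fun_prop
    · refine HasCompactSupport.intro hK fun x hx => ?_
      have : fderiv ℝ φ (t + c * x, x) = 0 := image_eq_zero_of_notMem_tsupport fun h =>
        hKn x hx (tsupport_fderiv_subset ℝ h)
      simp [this]

/-- The shear `t ↦ t + c x` makes the factor `F` independent of `x`; Fubini's theorem then leaves
the integral of the d'Alembertian over a characteristic line, which is zero. -/
theorem integral_travelling_mul_dAlembertian {φ : ℝ × ℝ → ℝ} (hφ : ContDiff ℝ ∞ φ)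
    (hc : HasCompactSupport φ) {F : ℝ → ℝ} (hF : Continuous F) {c : ℝ} (hc1 : c * c = 1) :
    ∫ p : ℝ × ℝ, F (p.1 - c * p.2) * dAlembertian φ p = 0 := by
  have hcont := continuous_dAlembertian hφ
  have hint : Integrable fun p : ℝ × ℝ => F (p.1 - c * p.2) * dAlembertian φ p := by
    apply Continuous.integrable_of_hasCompactSupport (by fun_prop)
    exact HasCompactSupport.intro hc.isCompact fun p hp => by simp [dAlembertian_eq_zero hφ hp]
  have hint2 : Integrable fun p : ℝ × ℝ => F p.1 * dAlembertian φ (p.1 + c * p.2, p.2) := by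
    apply Continuous.integrable_of_hasCompactSupport
    · have : Continuous fun p : ℝ × ℝ => dAlembertian φ (p.1 + c * p.2, p.2) :=
        hcont.comp (by fun_prop)
      fun_prop
    · refine HasCompactSupport.intro (hc.isCompact.image
        (f := fun p : ℝ × ℝ => (p.1 - c * p.2, p.2)) (by fun_prop)) fun p hp => ?_
      rw [dAlembertian_eq_zero hφ, mul_zero]
      exact fun h => hp ⟨_, h, by simp⟩
  rw [Measure.volume_eq_prod] at hint hint2 ⊢
  rw [integral_prod_symm _ hint]
  have h1 : ∀ x, ∫ t, F (t - c * x) * dAlembertian φ (t, x) =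
      ∫ t, F t * dAlembertian φ (t + c * x, x) := fun x => by
    rw [← integral_add_right_eq_self _ (c * x)]
    simp
  simp only [h1]
  rw [← integral_prod_symm _ hint2, integral_prod _ hint2]
  simp [integral_const_mul, integral_dAlembertian_line hφ hc hc1]

theorem weakWave_travelling (T : ℝ) (ℓ : ℝ → ℝ) {f g : ℝ → ℝ} (hf : Continuous f)
    (hg : Continuous g) : WeakWave T ℓ fun t x => f (t - x) + g (t + x) := by
  intro φ hφ hc _
  have hcont := continuous_dAlembertian hφ
  have hint : ∀ {F : ℝ × ℝ → ℝ}, Continuous F → Integrable fun p => F p * dAlembertian φ p := by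
    intro F hF
    apply Continuous.integrable_of_hasCompactSupport (by fun_prop)
    exact HasCompactSupport.intro hc.isCompact fun p hp => by simp [dAlembertian_eq_zero hφ hp]
  simp only [add_mul]
  rw [integral_add (hint (by fun_prop)) (hint (by fun_prop))]
  have h1 := integral_travelling_mul_dAlembertian hφ hc hf (c := 1) (by norm_num)
  have h2 := integral_travelling_mul_dAlembertian hφ hc hg (c := -1) (by norm_num)
  simp only [one_mul, neg_mul, sub_neg_eq_add] at h1 h2
  rw [h1, h2, add_zero]

/-! ### The parallelogram identity -/

/-- In the coordinates `ξ = t - x`, `η = t + x` the d'Alembertian is `4 ∂_ξ ∂_η`. -/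
theorem dAlembertian_char {P Q : ℝ → ℝ} (hP : ContDiff ℝ ∞ P) (hQ : ContDiff ℝ ∞ Q) (p : ℝ × ℝ) :
    dAlembertian (fun p => P (p.1 - p.2) * Q (p.1 + p.2)) p =
      4 * (deriv P (p.1 - p.2) * deriv Q (p.1 + p.2)) := by
  have hP1 : ∀ z, HasDerivAt P (deriv P z) z := fun z =>
    (hP.differentiable (by simp) z).hasDerivAt
  have hQ1 : ∀ z, HasDerivAt Q (deriv Q z) z := fun z =>
    (hQ.differentiable (by simp) z).hasDerivAt
  have hP2 : ∀ z, HasDerivAt (deriv P) (deriv (deriv P) z) z := fun z =>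
    (((contDiff_infty_iff_deriv.1 hP).2.differentiable (by simp)) z).hasDerivAt
  have hQ2 : ∀ z, HasDerivAt (deriv Q) (deriv (deriv Q) z) z := fun z =>
    (((contDiff_infty_iff_deriv.1 hQ).2.differentiable (by simp)) z).hasDerivAt
  obtain ⟨t, x⟩ := p
  have ta : ∀ {F F' : ℝ → ℝ}, (∀ z, HasDerivAt F (F' z) z) → ∀ x t : ℝ,
      HasDerivAt (fun t => F (t - x)) (F' (t - x)) t ∧
      HasDerivAt (fun t => F (t + x)) (F' (t + x)) t ∧
      HasDerivAt (fun x => F (t - x)) (-F' (t - x)) x ∧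
      HasDerivAt (fun x => F (t + x)) (F' (t + x)) x := by
    intro F F' hF x t
    refine ⟨?_, ?_, ?_, ?_⟩
    · exact (hF (t - x)).comp_sub_const t x
    · exact (hF (t + x)).comp_add_const t x
    · exact (hF (t - x)).comp_const_sub t x
    · exact (hF (t + x)).comp_const_add t x
  have h1 : deriv (fun t => P (t - x) * Q (t + x)) =
      fun t => deriv P (t - x) * Q (t + x) + P (t - x) * deriv Q (t + x) := by
    funext t
    exact ((ta hP1 x t).1.fun_mul (ta hQ1 x t).2.1).deriv
  have h2 : deriv (fun x => P (t - x) * Q (t + x)) =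
      fun x => -deriv P (t - x) * Q (t + x) + P (t - x) * deriv Q (t + x) := by
    funext x
    exact ((ta hP1 x t).2.2.1.fun_mul (ta hQ1 x t).2.2.2).deriv
  have h3 := (((ta hP2 x t).1.fun_mul (ta hQ1 x t).2.1).fun_add
    ((ta hP1 x t).1.fun_mul (ta hQ2 x t).2.1)).deriv
  have h4 := (((ta hP2 x t).2.2.1.fun_neg.fun_mul (ta hQ1 x t).2.2.2).fun_add
    ((ta hP1 x t).2.2.1.fun_mul (ta hQ2 x t).2.2.2)).deriv
  simp only [dAlembertian, iteratedDeriv_succ, iteratedDeriv_zero, h1, h2, h3, h4]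
  ring

/-- A smooth step, rising from `0` to `1` on `[α, α + ε]`. -/
def smoothStep (ε α z : ℝ) : ℝ := Real.smoothTransition ((z - α) / ε)

section smoothStep

variable {ε : ℝ}

theorem contDiff_smoothStep (ε α : ℝ) : ContDiff ℝ ∞ (smoothStep ε α) :=
  Real.smoothTransition.contDiff.comp (by fun_prop)

theorem smoothStep_of_le (hε : 0 < ε) {α z : ℝ} (h : z ≤ α) : smoothStep ε α z = 0 :=
  Real.smoothTransition.zero_of_nonpos (div_nonpos_of_nonpos_of_nonneg (by linarith) hε.le)

theorem smoothStep_of_ge (hε : 0 < ε) {α z : ℝ} (h : α + ε ≤ z) : smoothStep ε α z = 1 :=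
  Real.smoothTransition.one_of_one_le ((one_le_div hε).2 (by linarith))

theorem deriv_smoothStep_nonneg (hε : 0 < ε) (α z : ℝ) : 0 ≤ deriv (smoothStep ε α) z := by
  apply Monotone.deriv_nonneg
  intro x y h
  exact Real.smoothTransition.monotone (div_le_div_of_nonneg_right (by linarith) hε.le)

theorem continuous_deriv_smoothStep (ε α : ℝ) : Continuous (deriv (smoothStep ε α)) :=
  (contDiff_infty_iff_deriv.1 (contDiff_smoothStep ε α)).2.continuous

theorem deriv_smoothStep_eq_zero (hε : 0 < ε) {α z : ℝ} (h : z ∉ Icc α (α + ε)) :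
    deriv (smoothStep ε α) z = 0 := by
  rcases not_and_or.1 h with h | h
  · push Not at h
    have : smoothStep ε α =ᶠ[nhds z] fun _ => 0 := by
      filter_upwards [Iio_mem_nhds h] with w hw using smoothStep_of_le hε hw.le
    rw [this.deriv_eq, deriv_const]
  · push Not at h
    have : smoothStep ε α =ᶠ[nhds z] fun _ => 1 := by
      filter_upwards [Ioi_mem_nhds h] with w hw using smoothStep_of_ge hε hw.le
    rw [this.deriv_eq, deriv_const]

theorem deriv_smoothStep_translate (ε α z : ℝ) :
    deriv (smoothStep ε α) z = deriv (smoothStep ε 0) (z - α) := by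
  have : smoothStep ε α = fun z => smoothStep ε 0 (z - α) := by
    funext z
    simp [smoothStep]
  rw [this, deriv_comp_sub_const]

theorem exists_deriv_smoothStep_ne_zero (hε : 0 < ε) : ∃ z, deriv (smoothStep ε 0) z ≠ 0 := by
  by_contra! h
  have := is_const_of_deriv_eq_zero ((contDiff_smoothStep ε 0).differentiable (by simp)) h 0 ε
  rw [smoothStep_of_le hε le_rfl, smoothStep_of_ge hε (by simp)] at this
  exact zero_ne_one this

/-- A bump in characteristic coordinates, supported in `[α, α + ε] × [γ, γ + ε]`. -/
def charBump (ε α γ : ℝ) (p : ℝ × ℝ) : ℝ :=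
  deriv (smoothStep ε α) (p.1 - p.2) * deriv (smoothStep ε γ) (p.1 + p.2)

theorem continuous_charBump (ε α γ : ℝ) : Continuous (charBump ε α γ) :=
  ((continuous_deriv_smoothStep ε α).comp (by fun_prop)).mul
    ((continuous_deriv_smoothStep ε γ).comp (by fun_prop))

theorem charBump_nonneg (hε : 0 < ε) (α γ : ℝ) (p : ℝ × ℝ) : 0 ≤ charBump ε α γ p :=
  mul_nonneg (deriv_smoothStep_nonneg hε _ _) (deriv_smoothStep_nonneg hε _ _)

theorem mem_of_charBump_ne_zero (hε : 0 < ε) {α γ : ℝ} {p : ℝ × ℝ} (h : charBump ε α γ p ≠ 0) :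
    p.1 - p.2 ∈ Icc α (α + ε) ∧ p.1 + p.2 ∈ Icc γ (γ + ε) := by
  constructor
  · by_contra hc
    exact h (by rw [charBump, deriv_smoothStep_eq_zero hε hc, zero_mul])
  · by_contra hc
    exact h (by rw [charBump, deriv_smoothStep_eq_zero hε hc, mul_zero])

theorem hasCompactSupport_of_char {F : ℝ × ℝ → ℝ} {a b c d : ℝ}
    (h : ∀ p, F p ≠ 0 → p.1 - p.2 ∈ Icc a b ∧ p.1 + p.2 ∈ Icc c d) : HasCompactSupport F := by
  refine HasCompactSupport.intro
    (isCompact_Icc.prod isCompact_Icc : IsCompact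
      (Icc ((a + c) / 2) ((b + d) / 2) ×ˢ Icc ((c - b) / 2) ((d - a) / 2))) fun p hp => ?_
  by_contra hne
  obtain ⟨⟨h1, h2⟩, h3, h4⟩ := h p hne
  exact hp ⟨⟨by linarith, by linarith⟩, by linarith, by linarith⟩

theorem hasCompactSupport_charBump (hε : 0 < ε) (α γ : ℝ) :
    HasCompactSupport (charBump ε α γ) :=
  hasCompactSupport_of_char fun _ h => mem_of_charBump_ne_zero hε h

theorem integral_charBump (ε α γ : ℝ) :
    ∫ p, charBump ε α γ p = ∫ p, charBump ε 0 0 p := by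
  rw [← integral_add_right_eq_self _ (((α + γ) / 2, (γ - α) / 2) : ℝ × ℝ)]
  congr 1
  funext p
  rw [charBump, charBump, deriv_smoothStep_translate ε α, deriv_smoothStep_translate ε γ]
  congr 2 <;> simp only [Prod.fst_add, Prod.snd_add] <;> ring

theorem integral_charBump_pos (hε : 0 < ε) : 0 < ∫ p, charBump ε 0 0 p := by
  obtain ⟨z, hz⟩ := exists_deriv_smoothStep_ne_zero hε
  refine (continuous_charBump ε 0 0).integral_pos_of_hasCompactSupport_nonneg_nonzero
    (hasCompactSupport_charBump hε 0 0) (charBump_nonneg hε 0 0) (x := (z, 0)) ?_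
  simpa [charBump] using hz

/-- Testing against a bump is a weighted average, so it returns the value `v` up to the oscillation
`w` on the support of the bump. -/
theorem abs_integral_mul_charBump_sub_le (hε : 0 < ε) {Y : ℝ × ℝ → ℝ} (hY : Continuous Y)
    {α γ v w : ℝ} (h : ∀ p : ℝ × ℝ, p.1 - p.2 ∈ Icc α (α + ε) → p.1 + p.2 ∈ Icc γ (γ + ε) →
      |Y p - v| ≤ w) :
    |(∫ p, Y p * charBump ε α γ p) - v * ∫ p, charBump ε 0 0 p| ≤
      w * ∫ p, charBump ε 0 0 p := by
  have hc := continuous_charBump ε α γ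
  have hs := hasCompactSupport_charBump hε α γ
  have hi : Integrable (charBump ε α γ) := hc.integrable_of_hasCompactSupport hs
  have hi2 : Integrable fun p => Y p * charBump ε α γ p :=
    (hY.mul hc).integrable_of_hasCompactSupport hs.mul_left
  rw [← integral_charBump ε α γ, ← integral_const_mul, ← integral_const_mul,
    ← integral_sub hi2 (hi.const_mul v), ← Real.norm_eq_abs]
  apply norm_integral_le_of_norm_le (hi.const_mul w)
  refine Filter.Eventually.of_forall fun p => ?_
  rw [← sub_mul, Real.norm_eq_abs, abs_mul, abs_of_nonneg (charBump_nonneg hε _ _ p)]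
  by_cases h0 : charBump ε α γ p = 0
  · simp [h0]
  · obtain ⟨h1, h2⟩ := mem_of_charBump_ne_zero hε h0
    exact mul_le_mul_of_nonneg_right (h p h1 h2) (charBump_nonneg hε _ _ p)

end smoothStep

/-- A front that never recedes and is not faster than `1`. -/
def SlowFront (ℓ : ℝ → ℝ) (T : ℝ) : Prop :=
  ∀ s ∈ Icc 0 T, ∀ t ∈ Icc 0 T, s ≤ t → ℓ s ≤ ℓ t ∧ ℓ t - ℓ s ≤ t - s

/-- A step that increases `t - x` and decreases `t + x` moves away from the front at least as fast
as a front with speed in `[0, 1]` can follow. So a characteristic rectangle lies behind the front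
once its corner of least `t - x` and greatest `t + x` does. -/
theorem SlowFront.le_of_char {ℓ : ℝ → ℝ} {T t t₀ x x₀ : ℝ} (hℓ : SlowFront ℓ T)
    (ht : t ∈ Icc 0 T) (ht₀ : t₀ ∈ Icc 0 T) (h1 : t₀ - x₀ ≤ t - x) (h2 : t + x ≤ t₀ + x₀) :
    x - x₀ ≤ ℓ t - ℓ t₀ := by
  rcases le_total t t₀ with h | h
  · have := (hℓ t ht t₀ ht₀ h).2
    linarith
  · have := (hℓ t₀ ht₀ t ht h).1
    linarith

theorem mem_closedRegion_of_char {ℓ : ℝ → ℝ} {T a b c d : ℝ} (hℓ : SlowFront ℓ T)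
    (hbc : b ≤ c) (h0 : 0 ≤ a + c) (hT : b + d ≤ 2 * T)
    (hf : (d - a) / 2 ≤ ℓ ((a + d) / 2)) {p : ℝ × ℝ} (h1 : p.1 - p.2 ∈ Icc a b)
    (h2 : p.1 + p.2 ∈ Icc c d) : p ∈ closedRegion T ℓ := by
  obtain ⟨t, x⟩ := p
  simp only [mem_Icc] at h1 h2
  have ht : t ∈ Icc 0 T := ⟨by linarith, by linarith⟩
  have := hℓ.le_of_char (t₀ := (a + d) / 2) (x := x) (x₀ := (d - a) / 2) ht
    ⟨by linarith, by linarith⟩ (by linarith) (by linarith)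
  exact ⟨ht.1, ht.2, by simp only; linarith, by simp only; linarith⟩

theorem mem_openRegion_of_char {ℓ : ℝ → ℝ} {T a b c d ε : ℝ} (hε : 0 < ε) (hℓ : SlowFront ℓ T)
    (hbc : b ≤ c) (h0 : 0 ≤ a + c) (hT : b + d ≤ 2 * T)
    (hf : (d - a) / 2 ≤ ℓ ((a + d) / 2)) {p : ℝ × ℝ} (h1 : p.1 - p.2 ∈ Icc (a + ε) (b - ε))
    (h2 : p.1 + p.2 ∈ Icc (c + ε) (d - ε)) : p ∈ openRegion T ℓ := by
  obtain ⟨t, x⟩ := p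
  simp only [mem_Icc] at h1 h2
  have ht : t ∈ Icc 0 T := ⟨by linarith, by linarith⟩
  have := hℓ.le_of_char (t₀ := (a + d) / 2) (x := x) (x₀ := (d - a) / 2 - ε) ht
    ⟨by linarith, by linarith⟩ (by linarith) (by linarith)
  refine ⟨?_, ?_, ?_, ?_⟩ <;> simp only <;> linarith

theorem openRegion_subset_closedRegion (T : ℝ) (ℓ : ℝ → ℝ) :
    openRegion T ℓ ⊆ closedRegion T ℓ := fun _ h => ⟨h.1.le, h.2.1.le, h.2.2.1.le, h.2.2.2.le⟩

/-- The test function is a smoothed indicator of the rectangle `[a, b] × [c, d]` in characteristic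
coordinates. Its d'Alembertian `4 P' Q'` consists of four bumps at the corners, with alternating
signs, and so the weak equation is the parallelogram identity up to averaging. -/
theorem parallelogram_defect_le {T : ℝ} {ℓ : ℝ → ℝ} {y : ℝ → ℝ → ℝ} {Y : ℝ × ℝ → ℝ} {K : ℝ≥0}
    (hY : LipschitzWith K Y) (hyY : EqOn (fun p : ℝ × ℝ => y p.1 p.2) Y (closedRegion T ℓ))
    (hw : WeakWave T ℓ y) (hℓ : SlowFront ℓ T) {a b c d ε : ℝ} (hε : 0 < ε) (hab : a + 3 * ε ≤ b)
    (hbc : b ≤ c) (hcd : c + 3 * ε ≤ d) (h0 : 0 ≤ a + c) (hT : b + d ≤ 2 * T)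
    (hf : (d - a) / 2 ≤ ℓ ((a + d) / 2)) :
    |Y ((a + c) / 2, (c - a) / 2) - Y ((a + d) / 2, (d - a) / 2)
      - Y ((b + c) / 2, (c - b) / 2) + Y ((b + d) / 2, (d - b) / 2)| ≤ 12 * K * ε := by
  -- The steps occupy `[a + ε, a + 2ε]` and `[b - 2ε, b - ε]`; the margin `ε` keeps the support
  -- inside the open region.
  set P : ℝ → ℝ := fun z => smoothStep ε (a + ε) z - smoothStep ε (b - 2 * ε) z with hPdef
  set Q : ℝ → ℝ := fun z => smoothStep ε (c + ε) z - smoothStep ε (d - 2 * ε) z with hQdef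
  have hP : ContDiff ℝ ∞ P := (contDiff_smoothStep _ _).sub (contDiff_smoothStep _ _)
  have hQ : ContDiff ℝ ∞ Q := (contDiff_smoothStep _ _).sub (contDiff_smoothStep _ _)
  have hsupp : ∀ {α β z : ℝ}, α + 3 * ε ≤ β →
      smoothStep ε (α + ε) z - smoothStep ε (β - 2 * ε) z ≠ 0 → z ∈ Icc (α + ε) (β - ε) := by
    intro α β z hαβ hz
    by_contra hc
    rcases not_and_or.1 hc with h | h
    · push Not at h
      rw [smoothStep_of_le hε h.le, smoothStep_of_le hε (by linarith), sub_self] at hz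
      exact hz rfl
    · push Not at h
      rw [smoothStep_of_ge hε (by linarith), smoothStep_of_ge hε (by linarith), sub_self] at hz
      exact hz rfl
  have hdP : ∀ z, deriv P z = deriv (smoothStep ε (a + ε)) z -
      deriv (smoothStep ε (b - 2 * ε)) z := fun z =>
    deriv_fun_sub ((contDiff_smoothStep _ _).differentiable (by simp) z)
      ((contDiff_smoothStep _ _).differentiable (by simp) z)
  have hdQ : ∀ z, deriv Q z = deriv (smoothStep ε (c + ε)) z -
      deriv (smoothStep ε (d - 2 * ε)) z := fun z =>
    deriv_fun_sub ((contDiff_smoothStep _ _).differentiable (by simp) z)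
      ((contDiff_smoothStep _ _).differentiable (by simp) z)
  set φ : ℝ × ℝ → ℝ := fun p => P (p.1 - p.2) * Q (p.1 + p.2) with hφdef
  have hφ : ContDiff ℝ ∞ φ := (hP.comp (by fun_prop)).mul (hQ.comp (by fun_prop))
  have hφs : ∀ p, φ p ≠ 0 →
      p.1 - p.2 ∈ Icc (a + ε) (b - ε) ∧ p.1 + p.2 ∈ Icc (c + ε) (d - ε) := fun p hp =>
    ⟨hsupp hab (left_ne_zero_of_mul hp), hsupp hcd (right_ne_zero_of_mul hp)⟩
  have hts : tsupport φ ⊆ openRegion T ℓ := by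
    have h1 : tsupport φ ⊆ {p : ℝ × ℝ | p.1 - p.2 ∈ Icc (a + ε) (b - ε)} ∩
        {p : ℝ × ℝ | p.1 + p.2 ∈ Icc (c + ε) (d - ε)} := by
      apply closure_minimal (fun p hp => hφs p hp)
      exact (isClosed_Icc.preimage (by fun_prop)).inter (isClosed_Icc.preimage (by fun_prop))
    exact fun p hp => mem_openRegion_of_char hε hℓ hbc h0 hT hf (h1 hp).1 (h1 hp).2
  have hφc : HasCompactSupport φ := hasCompactSupport_of_char hφs
  have hw0 := hw φ hφ hφc hts
  have hYc := hY.continuous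
  have hi : ∀ α γ, Integrable fun p => Y p * charBump ε α γ p := fun α γ =>
    (hYc.mul (continuous_charBump ε α γ)).integrable_of_hasCompactSupport
      (hasCompactSupport_charBump hε α γ).mul_left
  set I : ℝ → ℝ → ℝ := fun α γ => ∫ p, Y p * charBump ε α γ p with hI
  have hsum : I (a + ε) (c + ε) - I (a + ε) (d - 2 * ε) - I (b - 2 * ε) (c + ε) +
      I (b - 2 * ε) (d - 2 * ε) = 0 := by
    have h1 : ∫ p : ℝ × ℝ, y p.1 p.2 * dAlembertian φ p =
        ∫ p : ℝ × ℝ, 4 * (Y p * charBump ε (a + ε) (c + ε) p - Y p * charBump ε (a + ε) (d - 2 * ε) p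
          - Y p * charBump ε (b - 2 * ε) (c + ε) p
          + Y p * charBump ε (b - 2 * ε) (d - 2 * ε) p) := by
      congr 1
      funext p
      have h2 : y p.1 p.2 * dAlembertian φ p = Y p * dAlembertian φ p := by
        by_cases hp : p ∈ tsupport φ
        · have := hyY (openRegion_subset_closedRegion T ℓ (hts hp))
          simp only at this
          rw [this]
        · rw [dAlembertian_eq_zero hφ hp, mul_zero, mul_zero]
      rw [h2, hφdef, dAlembertian_char hP hQ, hdP, hdQ]
      simp only [charBump]
      ring
    have i2 : Integrable fun p => Y p * charBump ε (a + ε) (c + ε) p -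
        Y p * charBump ε (a + ε) (d - 2 * ε) p := (hi _ _).sub (hi _ _)
    have i3 : Integrable fun p => Y p * charBump ε (a + ε) (c + ε) p -
        Y p * charBump ε (a + ε) (d - 2 * ε) p - Y p * charBump ε (b - 2 * ε) (c + ε) p :=
      i2.sub (hi _ _)
    rw [h1, integral_const_mul, integral_add i3 (hi _ _), integral_sub i2 (hi _ _),
      integral_sub (hi _ _) (hi _ _)] at hw0
    linarith
  set m := ∫ p, charBump ε 0 0 p with hm
  have hmpos : 0 < m := integral_charBump_pos hε
  -- The bump starts within `2ε` of the corner and has width `ε`, hence `3Kε` for each corner and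
  -- `12Kε` for the four together.
  have hest : ∀ {α γ ξ η : ℝ}, |α - ξ| ≤ 2 * ε → |γ - η| ≤ 2 * ε →
      |I α γ - Y ((ξ + η) / 2, (η - ξ) / 2) * m| ≤ (3 * K * ε) * m := by
    intro α γ ξ η h1 h2
    apply abs_integral_mul_charBump_sub_le hε hYc
    rintro ⟨t, x⟩ ⟨h3, h4⟩ ⟨h5, h6⟩
    simp only at h3 h4 h5 h6
    rw [abs_le] at h1 h2
    refine (hY.dist_le_mul _ _).trans ?_
    have : dist ((t, x) : ℝ × ℝ) ((ξ + η) / 2, (η - ξ) / 2) ≤ 3 * ε := by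
      rw [Prod.dist_eq, Real.dist_eq, Real.dist_eq]
      simp only
      apply max_le <;> rw [abs_le] <;> constructor <;> linarith [h1.1, h1.2, h2.1, h2.2]
    calc (K : ℝ) * _ ≤ K * (3 * ε) := mul_le_mul_of_nonneg_left this K.2
      _ = _ := by ring
  have e1 := hest (α := a + ε) (γ := c + ε) (ξ := a) (η := c)
    (by rw [abs_le]; constructor <;> linarith)
    (by rw [abs_le]; constructor <;> linarith)
  have e2 := hest (α := a + ε) (γ := d - 2 * ε) (ξ := a) (η := d)
    (by rw [abs_le]; constructor <;> linarith)
    (by rw [abs_le]; constructor <;> linarith)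
  have e3 := hest (α := b - 2 * ε) (γ := c + ε) (ξ := b) (η := c)
    (by rw [abs_le]; constructor <;> linarith)
    (by rw [abs_le]; constructor <;> linarith)
  have e4 := hest (α := b - 2 * ε) (γ := d - 2 * ε) (ξ := b) (η := d)
    (by rw [abs_le]; constructor <;> linarith)
    (by rw [abs_le]; constructor <;> linarith)
  rw [abs_le] at e1 e2 e3 e4
  rw [abs_le]
  constructor
  · refine le_of_mul_le_mul_right ?_ hmpos
    linarith [e1.1, e2.1, e3.1, e4.1, e1.2, e2.2, e3.2, e4.2]
  · refine le_of_mul_le_mul_right ?_ hmpos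
    linarith [e1.1, e2.1, e3.1, e4.1, e1.2, e2.2, e3.2, e4.2]

/-- The parallelogram identity for Lipschitz weak solutions of the wave equation, up to the
boundary of the region. -/
theorem WeakWave.parallelogram {T : ℝ} {ℓ : ℝ → ℝ} {y : ℝ → ℝ → ℝ} (hw : WeakWave T ℓ y)
    (hy : ∃ K : ℝ≥0, LipschitzOnWith K (fun p : ℝ × ℝ => y p.1 p.2) (closedRegion T ℓ))
    (hℓ : SlowFront ℓ T) {a b c d : ℝ} (hab : a ≤ b)
    (hbc : b ≤ c) (hcd : c ≤ d) (h0 : 0 ≤ a + c) (hT : b + d ≤ 2 * T)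
    (hf : (d - a) / 2 ≤ ℓ ((a + d) / 2)) :
    y ((a + c) / 2) ((c - a) / 2) + y ((b + d) / 2) ((d - b) / 2) =
      y ((a + d) / 2) ((d - a) / 2) + y ((b + c) / 2) ((c - b) / 2) := by
  rcases hab.eq_or_lt with rfl | hab
  · ring
  rcases hcd.eq_or_lt with rfl | hcd
  · ring
  obtain ⟨K, hK⟩ := hy
  -- Nothing is known of `y` off the region. A global Lipschitz extension makes every integrand
  -- continuous, and the test functions do not see the difference.
  obtain ⟨Y, hY, hyY⟩ := hK.extend_real
  have hmem : ∀ {ξ η : ℝ}, ξ ∈ Icc a b → η ∈ Icc c d →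
      y ((ξ + η) / 2) ((η - ξ) / 2) = Y ((ξ + η) / 2, (η - ξ) / 2) := by
    intro ξ η hξ hη
    refine hyY (mem_closedRegion_of_char (p := ((ξ + η) / 2, (η - ξ) / 2)) hℓ hbc h0 hT hf ?_ ?_)
    · convert hξ using 1
      ring
    · convert hη using 1
      ring
  rw [hmem (left_mem_Icc.2 hab.le) (left_mem_Icc.2 hcd.le),
    hmem (right_mem_Icc.2 hab.le) (right_mem_Icc.2 hcd.le),
    hmem (left_mem_Icc.2 hab.le) (right_mem_Icc.2 hcd.le),
    hmem (right_mem_Icc.2 hab.le) (left_mem_Icc.2 hcd.le)]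
  set δ := Y ((a + c) / 2, (c - a) / 2) - Y ((a + d) / 2, (d - a) / 2)
      - Y ((b + c) / 2, (c - b) / 2) + Y ((b + d) / 2, (d - b) / 2) with hδ
  have hlim : Filter.Tendsto (fun ε : ℝ => 12 * K * ε) (nhdsWithin 0 (Ioi 0)) (nhds 0) := by
    have : Continuous fun ε : ℝ => 12 * (K : ℝ) * ε := by fun_prop
    simpa using (this.tendsto 0).mono_left nhdsWithin_le_nhds
  have hle : |δ| ≤ 0 := by
    refine ge_of_tendsto hlim ?_
    have hpos : 0 < min ((b - a) / 3) ((d - c) / 3) := by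
      apply lt_min <;> linarith
    filter_upwards [Ioo_mem_nhdsGT hpos] with ε hε
    have h1 := hε.2.le.trans (min_le_left _ _)
    have h2 := hε.2.le.trans (min_le_right _ _)
    exact parallelogram_defect_le hY hyY hw hℓ hε.1 (by linarith) hbc (by linarith) h0 hT hf
  have := abs_nonpos_iff.1 hle
  linarith

/-! ### The flow rule of the front -/

/-- The velocity `dℓ/ds` of the front with respect to the characteristic variable `s = t - ℓ`. -/
def flowRate (κ f : ℝ → ℝ) (s x : ℝ) : ℝ := max (deriv f s ^ 2 / κ x - 1 / 2) 0

theorem flowRate_nonneg (κ f : ℝ → ℝ) (s x : ℝ) : 0 ≤ flowRate κ f s x := le_max_right _ _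

theorem sq_deriv_le {f : ℝ → ℝ} {M : ℝ≥0} (hf : LipschitzWith M f) (s : ℝ) :
    deriv f s ^ 2 ≤ (M : ℝ) ^ 2 := by
  have := norm_deriv_le_of_lipschitz (x₀ := s) hf
  rw [Real.norm_eq_abs] at this
  exact sq_le_sq' (by linarith [neg_abs_le (deriv f s)]) ((le_abs_self _).trans this)

theorem flowRate_le {κ f : ℝ → ℝ} {c₁ : ℝ} (hc₁ : 0 < c₁) {M : ℝ≥0} (hf : LipschitzWith M f)
    {x : ℝ} (hx : c₁ ≤ κ x) (s : ℝ) : flowRate κ f s x ≤ (M : ℝ) ^ 2 / c₁ := by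
  have h1 : deriv f s ^ 2 / κ x ≤ (M : ℝ) ^ 2 / c₁ :=
    div_le_div₀ (sq_nonneg _) (sq_deriv_le hf s) hc₁ hx
  exact max_le (by linarith) (by positivity)

theorem exists_flowRate_lipschitz {κ f : ℝ → ℝ} {c₁ : ℝ} (hc₁ : 0 < c₁)
    (hκ : ∀ x, 0 ≤ x → c₁ ≤ κ x) (hκL : LocallyLipschitzOn (Ici 0) κ) {M : ℝ≥0}
    (hf : LipschitzWith M f) (R : ℝ) : ∃ C : ℝ≥0, ∀ s, ∀ a ∈ Icc 0 R, ∀ b ∈ Icc 0 R,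
      |flowRate κ f s a - flowRate κ f s b| ≤ C * |a - b| := by
  obtain ⟨K, hK⟩ := (hκL.mono (Icc_subset_Ici_self : Icc 0 R ⊆ Ici 0)
    ).exists_lipschitzOnWith_of_compact isCompact_Icc
  refine ⟨⟨(M : ℝ) ^ 2 * (K / c₁ ^ 2), by positivity⟩, fun s a ha b hb => ?_⟩
  have hka := hκ a ha.1
  have hkb := hκ b hb.1
  refine (abs_max_sub_max_le_abs _ _ _).trans ?_
  have ha0 : 0 < κ a := hc₁.trans_le hka
  have hb0 : 0 < κ b := hc₁.trans_le hkb
  have e : deriv f s ^ 2 / κ a - 1 / 2 - (deriv f s ^ 2 / κ b - 1 / 2) =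
      deriv f s ^ 2 * ((κ b - κ a) / (κ a * κ b)) := by
    field_simp
    ring
  rw [e, abs_mul, abs_of_nonneg (sq_nonneg _), abs_div, abs_of_pos (mul_pos ha0 hb0)]
  have h1 : |κ b - κ a| ≤ K * |a - b| := by
    have := hK.dist_le_mul b hb a ha
    rwa [Real.dist_eq, Real.dist_eq, abs_sub_comm b a] at this
  have h2 : |κ b - κ a| / (κ a * κ b) ≤ K * |a - b| / c₁ ^ 2 := by
    apply div_le_div₀ (by positivity) h1 (by positivity)
    nlinarith
  calc _ ≤ (M : ℝ) ^ 2 * (K * |a - b| / c₁ ^ 2) :=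
        mul_le_mul (sq_deriv_le hf s) h2 (by positivity) (by positivity)
    _ = (M : ℝ) ^ 2 * (K / c₁ ^ 2) * |a - b| := by ring

/-- With `p (1 + v) = -2F` the energy release rate is `2F² (1 - v)/(1 + v)`. If `v = 0`, Griffith's
inequality says `F²/k ≤ 1/2`; otherwise equality with `k` is `v = (1 - v)(F²/k - 1/2)`. The factor
`1 - v` is `ds/dt` for `s = t - ℓ`. -/
theorem flow_of_griffith {k v p F : ℝ} (hk : 0 < k) (hv : 0 ≤ v) (hv1 : v < 1)
    (hp : p * (1 + v) = -2 * F) (h1 : energyReleaseRate v p ≤ k)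
    (h2 : v * (energyReleaseRate v p - k) = 0) : v = (1 - v) * max (F ^ 2 / k - 1 / 2) 0 := by
  have hv2 : 0 < 1 + v := by linarith
  have hE : energyReleaseRate v p * (1 + v) = 2 * F ^ 2 * (1 - v) := by
    have hF : F = -(p * (1 + v)) / 2 := by linarith
    rw [energyReleaseRate, hF]
    ring
  have hd : F ^ 2 / k * k = F ^ 2 := div_mul_cancel₀ _ hk.ne'
  set r := F ^ 2 / k
  rcases mul_eq_zero.1 h2 with h | h
  · subst h
    have : r - 1 / 2 ≤ 0 := by
      have : r * k ≤ 1 / 2 * k := by rw [hd]; nlinarith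
      have := le_of_mul_le_mul_right this hk
      linarith
    rw [max_eq_right this, mul_zero]
  · have h3 : k * (1 + v) = k * (2 * r * (1 - v)) := by
      have : energyReleaseRate v p = k := by linarith
      rw [← this, hE, this, ← hd]
      ring
    have h4 := mul_left_cancel₀ hk.ne' h3
    have h5 : v = (1 - v) * (r - 1 / 2) := by linarith
    have h6 : 0 ≤ r - 1 / 2 := by
      by_contra hc
      push Not at hc
      nlinarith
    rw [max_eq_left h6]
    exact h5

/-- The map `t ↦ t - ℓ t` does not contract if the speed of the front is bounded away from `1`. -/
theorem expanding_of_slope {ℓ : ℝ → ℝ} {q τ : ℝ} (hq : q < 1)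
    (hslope : ∀ s ∈ Icc 0 τ, ∀ t ∈ Icc 0 τ, s ≤ t → ℓ s ≤ ℓ t ∧ ℓ t - ℓ s ≤ q * (t - s)) :
    ∀ t ∈ Icc 0 τ, ∀ t' ∈ Icc 0 τ,
      |t - t'| ≤ (⟨(1 - q)⁻¹, by rw [inv_nonneg]; linarith⟩ : ℝ≥0) *
        |(t - ℓ t) - (t' - ℓ t')| := by
  have hmain : ∀ t ∈ Icc 0 τ, ∀ t' ∈ Icc 0 τ, t ≤ t' →
      |t - t'| ≤ (1 - q)⁻¹ * |(t - ℓ t) - (t' - ℓ t')| := by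
    intro t ht t' ht' h
    have := (hslope t ht t' ht' h).2
    rw [le_inv_mul_iff₀ (by linarith), abs_sub_comm, abs_of_nonneg (by linarith),
      abs_sub_comm]
    refine le_trans ?_ (le_abs_self _)
    linarith
  intro t ht t' ht'
  rcases le_total t t' with h | h
  · exact hmain t ht t' ht' h
  · rw [abs_sub_comm, abs_sub_comm (t - ℓ t)]
    exact hmain t' ht' t ht h

/-- The uniqueness theorem for the flow rule: the front of any solution lies on the curve
`ℓ = w (t - ℓ)`, where `w` solves the flow rule in the characteristic variable. -/
theorem front_eq_of_flow {κ f w ℓ : ℝ → ℝ} {c₁ : ℝ} (hc₁ : 0 < c₁)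
    (hκ : ∀ x, 0 ≤ x → c₁ ≤ κ x) (hκL : LocallyLipschitzOn (Ici 0) κ) {M W : ℝ≥0}
    (hf : LipschitzWith M f) (hw : LipschitzWith W w) (hwm : Monotone w)
    {ℓ₀ S τ q : ℝ} (hℓ₀ : 0 < ℓ₀) (hw₀ : w (-ℓ₀) = ℓ₀)
    (hode : ∀ᵐ s, s ∈ Ioo (-ℓ₀) S → HasDerivAt w (flowRate κ f s (w s)) s)
    (hτ : 0 ≤ τ) (hℓ : LipschitzIcc ℓ 0 τ) (hℓ0 : ℓ 0 = ℓ₀) (hq : q < 1)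
    (hslope : ∀ s ∈ Icc 0 τ, ∀ t ∈ Icc 0 τ, s ≤ t → ℓ s ≤ ℓ t ∧ ℓ t - ℓ s ≤ q * (t - s))
    (hS : τ - ℓ τ ≤ S)
    (hflow : ∀ᵐ t, t ∈ Ioo 0 τ → 0 ≤ deriv ℓ t ∧
      deriv ℓ t = (1 - deriv ℓ t) * flowRate κ f (t - ℓ t) (ℓ t)) :
    ℓ τ = w (τ - ℓ τ) := by
  have hmono : ∀ s ∈ Icc 0 τ, ∀ t ∈ Icc 0 τ, s < t → s - ℓ s < t - ℓ t := by
    intro s hs t ht hst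
    have := (hslope s hs t ht hst.le).2
    nlinarith
  have hτm : τ ∈ Icc 0 τ := right_mem_Icc.2 hτ
  have h0m : (0 : ℝ) ∈ Icc 0 τ := left_mem_Icc.2 hτ
  obtain ⟨C, hC⟩ := exists_flowRate_lipschitz hc₁ hκ hκL hf (max (ℓ τ) (w S))
  have hexp := expanding_of_slope hq hslope
  -- The equation for `w` holds for a.e. `s`; as `t ↦ t - ℓ t` is expanding, it also holds at `s = t
  -- - ℓ t` for a.e. `t`.
  have hae := ae_comp_of_expanding hexp hode
  have hD : LipschitzIcc (fun t => ℓ t - w (t - ℓ t)) 0 τ := by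
    obtain ⟨K, hK⟩ := hℓ
    exact ⟨_, hK.sub (hw.comp_lipschitzOnWith (LipschitzOnWith.sub (LipschitzWith.id.lipschitzOnWith) hK))⟩
  -- Grönwall for `ℓ t - w (t - ℓ t)`: its derivative is `1 - ℓ'` times the difference of the flow
  -- rates at `ℓ t` and at `w (t - ℓ t)`, and the flow rate is Lipschitz in the position.
  have key := eq_zero_of_ae_abs_deriv_le (C := C)
    (g' := fun t => deriv ℓ t - flowRate κ f (t - ℓ t) (w (t - ℓ t)) * (1 - deriv ℓ t)) hτ
    (hD.absolutelyContinuous hτ) (by simp [hℓ0, hw₀]) ?_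
  · linarith
  · filter_upwards [hae, hℓ.ae_differentiableAt, hflow] with t h1 h2 h3 ht
    have htm := Ioo_subset_Icc_self ht
    obtain ⟨h4, h5⟩ := h3 ht
    have hs1 : -ℓ₀ < t - ℓ t := by
      have := hmono 0 h0m t htm ht.1
      rwa [hℓ0, zero_sub] at this
    have hs2 : t - ℓ t < S := (hmono t htm τ hτm ht.2).trans_le hS
    have h6 := h1 htm ⟨hs1, hs2⟩
    have h7 := (h2 ht).hasDerivAt
    constructor
    · exact h7.fun_sub (h6.comp t ((hasDerivAt_id t).fun_sub h7))
    · have hle : 1 - deriv ℓ t ≤ 1 := by linarith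
      have hr := flowRate_nonneg κ f (t - ℓ t) (ℓ t)
      have hge : 0 ≤ 1 - deriv ℓ t := by
        by_contra hc
        push Not at hc
        nlinarith
      have e : deriv ℓ t - flowRate κ f (t - ℓ t) (w (t - ℓ t)) * (1 - deriv ℓ t) =
          (1 - deriv ℓ t) * (flowRate κ f (t - ℓ t) (ℓ t) -
            flowRate κ f (t - ℓ t) (w (t - ℓ t))) := by
        linear_combination h5
      rw [e, abs_mul, abs_of_nonneg hge]
      have h8 : ℓ₀ ≤ ℓ t := hℓ0 ▸ (hslope 0 h0m t htm ht.1.le).1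
      have h9 : ℓ₀ ≤ w (t - ℓ t) := hw₀ ▸ hwm hs1.le
      have h10 := hC (t - ℓ t) (ℓ t)
        ⟨by linarith, ((hslope t htm τ hτm ht.2.le).1).trans (le_max_left _ _)⟩
        (w (t - ℓ t)) ⟨by linarith, (hwm hs2.le).trans (le_max_right _ _)⟩
      exact (mul_le_of_le_one_left (abs_nonneg _) hle).trans h10

/-! ### Fronts of solutions -/

theorem abs_le_of_hasDerivWithinAt_of_lipschitz {h : ℝ → ℝ} {p b : ℝ} {K : ℝ≥0} (hb : 0 < b)
    (hp : HasDerivWithinAt h p (Icc 0 b) b) (hK : LipschitzOnWith K h (Icc 0 b)) : |p| ≤ K := by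
  have h1 := (hp.mono (Ioo_subset_Icc_self (a := 0) (b := b)))
  rw [hasDerivWithinAt_iff_tendsto_slope' (by simp)] at h1
  have hne : (nhdsWithin b (Ioo 0 b)).NeBot := by
    rw [nhdsWithin_Ioo_eq_nhdsLT hb]
    infer_instance
  refine le_of_tendsto h1.abs ?_
  filter_upwards [self_mem_nhdsWithin] with x hx
  have h2 := hK.dist_le_mul x (Ioo_subset_Icc_self hx) b (right_mem_Icc.2 hb.le)
  have h3 : 0 < |x - b| := abs_pos.2 (sub_ne_zero.2 hx.2.ne)
  rw [slope_def_field, abs_div, abs_sub_comm (h x), abs_sub_comm x b]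
  rw [Real.dist_eq, Real.dist_eq, abs_sub_comm, abs_sub_comm x b] at h2
  rw [abs_sub_comm] at h3
  rw [abs_sub_comm (h b)] at h2 ⊢
  rw [div_le_iff₀ h3]
  exact h2

namespace IsSolution

variable {κ : ℝ → ℝ} {T ℓ₀ : ℝ} {y₀ y₁ u ℓ : ℝ → ℝ} {y : ℝ → ℝ → ℝ}

theorem ae_griffith (h : IsSolution κ T ℓ₀ y₀ y₁ u ℓ y) : ∀ᵐ t, t ∈ Ioo 0 T →
    ∃ p : ℝ, HasDerivWithinAt (fun x => y t x) p (Icc 0 (ℓ t)) (ℓ t) ∧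
      0 ≤ deriv ℓ t ∧
      energyReleaseRate (deriv ℓ t) p ≤ κ (ℓ t) ∧
      deriv ℓ t * (energyReleaseRate (deriv ℓ t) p - κ (ℓ t)) = 0 := by
  have := h.griffith
  rw [Griffith, ae_restrict_iff' measurableSet_Icc] at this
  filter_upwards [this] with t ht htm using ht (Ioo_subset_Icc_self htm)

theorem le_front (h : IsSolution κ T ℓ₀ y₀ y₁ u ℓ y) {t : ℝ} (ht : t ∈ Icc 0 T) :
    ℓ₀ ≤ ℓ t := by
  have hl : LipschitzIcc ℓ 0 t := by
    obtain ⟨K, hK⟩ := h.front_lipschitz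
    exact ⟨K, hK.mono (Icc_subset_Icc_right ht.2)⟩
  have := sub_nonneg_of_ae_hasDerivAt (g' := deriv ℓ) ht.1 (hl.absolutelyContinuous ht.1) (by
    filter_upwards [hl.ae_differentiableAt, h.ae_griffith] with s h1 h2 hs
    obtain ⟨p, -, h3, -⟩ := h2 ⟨hs.1, hs.2.trans_le ht.2⟩
    exact ⟨(h1 hs).hasDerivAt, h3⟩)
  rw [h.front_initial] at this
  linarith

/-- Where the front moves, `½ (1 - v²) p² = κ ≥ c₁`, while `|p|` is at most the Lipschitz constant
of `y`. This keeps `v²` uniformly below `1`. -/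
theorem exists_front_slope (h : IsSolution κ T ℓ₀ y₀ y₁ u ℓ y) (hℓ₀ : 0 < ℓ₀) {c₁ : ℝ}
    (hc₁ : 0 < c₁) (hκ : ∀ x, 0 ≤ x → c₁ ≤ κ x) :
    ∃ q < 1, ∀ s ∈ Icc 0 T, ∀ t ∈ Icc 0 T, s ≤ t → ℓ s ≤ ℓ t ∧ ℓ t - ℓ s ≤ q * (t - s) := by
  obtain ⟨K, hK⟩ := h.lipschitz
  set r : ℝ := 1 - 2 * c₁ / ((K : ℝ) ^ 2 + 1) with hr
  have hpos : 0 < (K : ℝ) ^ 2 + 1 := by positivity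
  have hr1 : r < 1 := by
    have : 0 < 2 * c₁ / ((K : ℝ) ^ 2 + 1) := by positivity
    linarith
  -- From `v² ≤ r` follows `v ≤ (1 + v²)/2 ≤ (1 + r)/2`; the `0` covers the times at rest.
  refine ⟨max ((1 + r) / 2) 0, max_lt (by linarith) one_pos,
    lipschitzIcc_of_ae_deriv h.front_lipschitz ?_⟩
  filter_upwards [h.ae_griffith] with t ht htm
  obtain ⟨p, h1, h2, h3, h4⟩ := ht htm
  refine ⟨h2, ?_⟩
  have htc := Ioo_subset_Icc_self htm
  have hℓt : 0 < ℓ t := hℓ₀.trans_le (h.le_front htc)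
  have hp : |p| ≤ K := by
    apply abs_le_of_hasDerivWithinAt_of_lipschitz hℓt h1
    apply LipschitzOnWith.of_dist_le_mul
    intro x hx x' hx'
    have := hK.dist_le_mul (t, x) ⟨htc.1, htc.2, hx.1, hx.2⟩ (t, x') ⟨htc.1, htc.2, hx'.1, hx'.2⟩
    simpa [Prod.dist_eq] using this
  have hp2 : p ^ 2 ≤ (K : ℝ) ^ 2 + 1 := by
    rw [← sq_abs]
    have := pow_le_pow_left₀ (abs_nonneg p) hp 2
    linarith
  rcases mul_eq_zero.1 h4 with h5 | h5
  · rw [h5]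
    exact le_max_right _ _
  · refine le_trans ?_ (le_max_left _ _)
    set v := deriv ℓ t
    have h6 : c₁ ≤ 1 / 2 * (1 - v ^ 2) * p ^ 2 := by
      have := hκ _ hℓt.le
      rw [energyReleaseRate] at h5
      linarith
    have h7 : 0 ≤ 1 - v ^ 2 := by
      by_contra hc
      push Not at hc
      nlinarith [sq_nonneg p]
    have h8 : v ^ 2 ≤ r := by
      have : 2 * c₁ / ((K : ℝ) ^ 2 + 1) ≤ 1 - v ^ 2 := by
        rw [div_le_iff₀ hpos]
        nlinarith
      linarith
    nlinarith [sq_nonneg (v - 1)]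

end IsSolution

/-- The flow rule at a single time, for a solution that splits as `f (t - x) + g (t + x)` ahead of
the characteristic through the front. -/
theorem hasDerivWithinAt_front_relation {ℓ f : ℝ → ℝ} {y : ℝ → ℝ → ℝ} {T t s p v F : ℝ}
    (hℓm : SlowFront ℓ T) (hℓpos : 0 < ℓ t) (ht : t ∈ Ioo 0 T)
    (hzero : ∀ t ∈ Icc 0 T, y t (ℓ t) = 0)
    (hsplit : ∀ t x t' x', (t, x) ∈ closedRegion T ℓ → (t', x') ∈ closedRegion T ℓ →
      t + x = t' + x' → t - x ≤ s → t' - x' ≤ s → y t x - f (t - x) = y t' x' - f (t' - x'))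
    (hs : t - ℓ t < s) (hp : HasDerivWithinAt (fun x => y t x) p (Icc 0 (ℓ t)) (ℓ t))
    (hℓ : HasDerivAt ℓ v t) (hf : HasDerivAt f F (t - ℓ t)) : p * (1 + v) = -2 * F := by
  set η₀ := t + ℓ t with hη₀
  -- The left-going part read off at time `t` as a function of `η = t + x`; only `η ≤ t + ℓ t` is
  -- available, so the derivative is one-sided.
  have hG : HasDerivWithinAt (fun η => y t (η - t) - f (2 * t - η)) (p + F)
      (Icc t η₀) η₀ := by
    have h1 : HasDerivWithinAt (fun η => y t (η - t)) p (Icc t η₀) η₀ := by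
      have e : ℓ t = η₀ - t := by rw [hη₀]; ring
      have hp' : HasDerivWithinAt (fun x => y t x) p (Icc 0 (ℓ t)) (η₀ - t) := by rwa [← e]
      have hm : MapsTo (fun η => η - t) (Icc t η₀) (Icc 0 (ℓ t)) := fun η hη =>
        ⟨sub_nonneg.2 hη.1, by simp only; linarith [hη.2]⟩
      have hd : HasDerivWithinAt (fun η => η - t) 1 (Icc t η₀) η₀ :=
        ((hasDerivAt_id η₀).sub_const t).hasDerivWithinAt
      simpa [Function.comp_def] using hp'.scomp η₀ hd hm
    have h2 : HasDerivAt (fun η => f (2 * t - η)) (-F) η₀ := by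
      have e : t - ℓ t = 2 * t - η₀ := by rw [hη₀]; ring
      rw [e] at hf
      exact hf.comp_const_sub (2 * t) η₀
    exact (h1.fun_sub h2.hasDerivWithinAt).congr_deriv (by ring)
  have hη : HasDerivAt (fun τ => τ + ℓ τ) (1 + v) t := (hasDerivAt_id t).fun_add hℓ
  have hcont : ContinuousAt (fun τ => τ + ℓ τ) t := hη.continuousAt
  -- For `τ ∈ A` the front point `(τ, ℓ τ)` and the point of time `t` on the same line `t + x =
  -- const` both lie in the region and ahead of `s`. Times after `t` are excluded: their line has
  -- left the region by time `t`.
  set A : Set ℝ := {τ | τ ≤ t ∧ 0 ≤ τ ∧ t ≤ τ + ℓ τ ∧ 2 * t - (τ + ℓ τ) ≤ s} with hA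
  have hAn : A ∈ nhdsWithin t (Iic t) := by
    have e1 : ∀ᶠ τ in nhds t, 0 ≤ τ := Ici_mem_nhds ht.1
    have e2 : ∀ᶠ τ in nhds t, t < τ + ℓ τ :=
      hcont.eventually (Ioi_mem_nhds (by linarith))
    have e3 : ∀ᶠ τ in nhds t, 2 * t - s < τ + ℓ τ :=
      hcont.eventually (Ioi_mem_nhds (by linarith))
    filter_upwards [self_mem_nhdsWithin, nhdsWithin_le_nhds e1, nhdsWithin_le_nhds e2,
      nhdsWithin_le_nhds e3] with τ h1 h2 h3 h4
    exact ⟨h1, h2, h3.le, by linarith⟩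
  have htT : t ∈ Icc 0 T := Ioo_subset_Icc_self ht
  have hAT : ∀ τ ∈ A, τ ∈ Icc 0 T := fun τ hτ => ⟨hτ.2.1, hτ.1.trans ht.2.le⟩
  have htA : t ∈ A := mem_of_mem_nhdsWithin self_mem_Iic hAn
  have hmaps : MapsTo (fun τ => τ + ℓ τ) A (Icc t η₀) := by
    intro τ hτ
    refine ⟨hτ.2.2.1, ?_⟩
    have := (hℓm τ (hAT τ hτ) t htT hτ.1).1
    simp only [hη₀]
    linarith [hτ.1]
  have hcomp := (hG.scomp t hη.hasDerivWithinAt hmaps)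
  have hfr : HasDerivAt (fun τ => -f (τ - ℓ τ)) (-(F * (1 - v))) t :=
    (hf.comp t ((hasDerivAt_id t).fun_sub hℓ)).fun_neg
  have heq : ∀ τ ∈ A, -f (τ - ℓ τ) =
      ((fun η => y t (η - t) - f (2 * t - η)) ∘ fun τ => τ + ℓ τ) τ := by
    intro τ hτ
    have hm := hmaps hτ
    have h1 := (hℓm τ (hAT τ hτ) t htT hτ.1)
    have hpos : 0 ≤ ℓ τ := by
      have := hτ.2.2.1
      linarith [hτ.1]
    have := hsplit τ (ℓ τ) t (τ + ℓ τ - t) ⟨(hAT τ hτ).1, (hAT τ hτ).2, hpos, le_rfl⟩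
      ⟨htT.1, htT.2, by simpa using hm.1, by simp only; linarith [hm.2]⟩ (by ring)
      (by linarith [h1.2]) (by linarith [hτ.2.2.2])
    rw [hzero τ (hAT τ hτ)] at this
    simp only [Function.comp_apply]
    have e : 2 * t - (τ + ℓ τ) = t - (τ + ℓ τ - t) := by ring
    rw [e, ← this]
    ring
  have h1 := (hcomp.congr heq (heq t htA)).mono_of_mem_nhdsWithin hAn
  -- Differentiating `-f(τ - ℓ τ)` in two ways gives `(1 + v)(p + F) = -F (1 - v)`.
  have h2 := (uniqueDiffOn_Iic t t self_mem_Iic).eq_deriv _ h1 hfr.hasDerivWithinAt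
  rw [smul_eq_mul] at h2
  linarith

/-! ### Uniqueness -/

/-- The front position `w` as a function of the characteristic variable `s = t - ℓ`, up to `s = S`,
when the profile travelling to the right is `f`. -/
structure FrontProfile (κ : ℝ → ℝ) (ℓ₀ S : ℝ) (f w : ℝ → ℝ) : Prop where
  lipschitz_right : ∃ M : ℝ≥0, LipschitzWith M f
  lipschitz_front : ∃ W : ℝ≥0, LipschitzWith W w
  monotone_front : Monotone w
  front_start : w (-ℓ₀) = ℓ₀
  flow : ∀ᵐ s, s ∈ Ioo (-ℓ₀) S → HasDerivAt w (flowRate κ f s (w s)) s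
  nonneg : 0 ≤ S

/-- A d'Alembert representation of a motion of the front: the profile `f` travelling to the right,
the profile `g` travelling to the left, and the front position `w`. The front passes the
characteristic `s = S` at time `T`. -/
structure Profile (κ : ℝ → ℝ) (T ℓ₀ : ℝ) (y₀ y₁ : ℝ → ℝ) (S : ℝ) (f g w : ℝ → ℝ) : Prop
    extends FrontProfile κ ℓ₀ S f w where
  lipschitz_left : ∃ M : ℝ≥0, LipschitzWith M g
  final : S + w S = T
  initial_right : ∀ᵐ x, x ∈ Ioo 0 ℓ₀ → HasDerivAt f ((y₁ x - deriv y₀ x) / 2) (-x)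
  initial_left : ∀ x ∈ Icc 0 ℓ₀, g x = y₀ x - f (-x)
  reflection : ∀ s ∈ Icc (-ℓ₀) S, g (s + 2 * w s) = -f s

/-- The value of `y` at the point with characteristic coordinates `t - x = ξ`, `t + x = η`. -/
def charVal (y : ℝ → ℝ → ℝ) (ξ η : ℝ) : ℝ := y ((ξ + η) / 2) ((η - ξ) / 2)

/-- The closed space-time region in characteristic coordinates. -/
def CharMem (T : ℝ) (ℓ : ℝ → ℝ) (ξ η : ℝ) : Prop :=
  0 ≤ ξ + η ∧ ξ + η ≤ 2 * T ∧ ξ ≤ η ∧ (η - ξ) / 2 ≤ ℓ ((ξ + η) / 2)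

/-- Ahead of the characteristic `ξ = s`, the function `y` is `f (t - x)` plus a function of
`t + x`. -/
def SplitUpTo (T : ℝ) (ℓ : ℝ → ℝ) (y : ℝ → ℝ → ℝ) (f : ℝ → ℝ) (s : ℝ) : Prop :=
  ∀ ξ₁ ξ₂ η, CharMem T ℓ ξ₁ η → CharMem T ℓ ξ₂ η → ξ₁ ≤ ξ₂ → ξ₂ ≤ s →
    charVal y ξ₁ η - f ξ₁ = charVal y ξ₂ η - f ξ₂

theorem charVal_sub_add (y : ℝ → ℝ → ℝ) (t x : ℝ) : charVal y (t - x) (t + x) = y t x := by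
  rw [charVal]
  congr 1 <;> ring

theorem charMem_sub_add {T : ℝ} {ℓ : ℝ → ℝ} {t x : ℝ} :
    CharMem T ℓ (t - x) (t + x) ↔ (t, x) ∈ closedRegion T ℓ := by
  have e1 : (t - x + (t + x)) / 2 = t := by ring
  have e2 : (t + x - (t - x)) / 2 = x := by ring
  rw [CharMem, e1, e2]
  constructor
  · rintro ⟨h1, h2, h3, h4⟩
    exact ⟨by simp only; linarith, by simp only; linarith, by simp only; linarith, h4⟩
  · rintro ⟨h1, h2, h3, h4⟩
    simp only at h1 h2 h3 h4
    exact ⟨by linarith, by linarith, by linarith, h4⟩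

theorem CharMem.between {T : ℝ} {ℓ : ℝ → ℝ} (hℓ : SlowFront ℓ T) {ξ₁ ξ ξ₂ η : ℝ}
    (h1 : CharMem T ℓ ξ₁ η) (h2 : CharMem T ℓ ξ₂ η) (h : ξ₁ ≤ ξ) (h' : ξ ≤ ξ₂) :
    CharMem T ℓ ξ η := by
  obtain ⟨a1, a2, a3, a4⟩ := h1
  obtain ⟨b1, b2, b3, b4⟩ := h2
  refine ⟨by linarith, by linarith, by linarith, ?_⟩
  have := hℓ.le_of_char (t := (ξ + η) / 2) (t₀ := (ξ₁ + η) / 2) (x := (η - ξ) / 2)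
    (x₀ := (η - ξ₁) / 2) ⟨by linarith, by linarith⟩ ⟨by linarith, by linarith⟩ (by linarith)
    (by linarith)
  linarith

/-- The qualitative facts about a solution that its uniqueness relies on. -/
structure FrontFacts (T ℓ₀ : ℝ) (ℓ : ℝ → ℝ) (y : ℝ → ℝ → ℝ) (q : ℝ) : Prop where
  lt_one : q < 1
  lipschitz : LipschitzIcc ℓ 0 T
  slope : ∀ s ∈ Icc 0 T, ∀ t ∈ Icc 0 T, s ≤ t → ℓ s ≤ ℓ t ∧ ℓ t - ℓ s ≤ q * (t - s)
  start : ℓ 0 = ℓ₀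
  zero : ∀ t ∈ Icc 0 T, y t (ℓ t) = 0
  parallelogram : ∀ {a b c d : ℝ}, a ≤ b → b ≤ c → c ≤ d → 0 ≤ a + c → b + d ≤ 2 * T →
    (d - a) / 2 ≤ ℓ ((a + d) / 2) →
      charVal y a c + charVal y b d = charVal y a d + charVal y b c

namespace FrontFacts

variable {T ℓ₀ q : ℝ} {ℓ : ℝ → ℝ} {y : ℝ → ℝ → ℝ}

theorem slowFront (h : FrontFacts T ℓ₀ ℓ y q) : SlowFront ℓ T := by
  intro s hs t ht hst
  obtain ⟨h1, h2⟩ := h.slope s hs t ht hst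
  exact ⟨h1, by nlinarith [h.lt_one]⟩

theorem le_front (h : FrontFacts T ℓ₀ ℓ y q) {t : ℝ} (ht : t ∈ Icc 0 T) : ℓ₀ ≤ ℓ t :=
  h.start ▸ (h.slope 0 ⟨le_rfl, ht.1.trans ht.2⟩ t ht ht.1).1

theorem sub_strictMono (h : FrontFacts T ℓ₀ ℓ y q) :
    StrictMonoOn (fun t => t - ℓ t) (Icc 0 T) := by
  intro s hs t ht hst
  have := (h.slope s hs t ht hst.le).2
  have := h.lt_one
  simp only
  nlinarith

theorem continuousOn (h : FrontFacts T ℓ₀ ℓ y q) : ContinuousOn ℓ (Icc 0 T) := by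
  obtain ⟨K, hK⟩ := h.lipschitz
  exact hK.continuousOn

theorem neg_le_of_charMem (h : FrontFacts T ℓ₀ ℓ y q) {ξ η : ℝ} (hm : CharMem T ℓ ξ η) :
    -ℓ₀ ≤ ξ := by
  obtain ⟨h1, h2, h3, h4⟩ := hm
  have := (h.slowFront 0 ⟨le_rfl, by linarith⟩ ((ξ + η) / 2) ⟨by linarith, by linarith⟩
    (by linarith)).2
  rw [h.start] at this
  linarith

theorem charMem_of_le (h : FrontFacts T ℓ₀ ℓ y q) {ξ η : ℝ} (h0 : 0 ≤ ξ + η)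
    (hT : ξ + η ≤ 2 * T) (hξη : ξ ≤ η) (hle : η - ξ ≤ 2 * ℓ₀) : CharMem T ℓ ξ η := by
  refine ⟨h0, hT, hξη, ?_⟩
  have := h.le_front (t := (ξ + η) / 2) ⟨by linarith, by linarith⟩
  linarith

theorem exists_sub_eq (h : FrontFacts T ℓ₀ ℓ y q) {t s : ℝ} (ht : t ∈ Icc 0 T)
    (h1 : -ℓ₀ ≤ s) (h2 : s ≤ t - ℓ t) : ∃ τ ∈ Icc 0 t, τ - ℓ τ = s := by
  have hc : ContinuousOn (fun t => t - ℓ t) (Icc 0 t) :=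
    continuousOn_id.sub (h.continuousOn.mono (Icc_subset_Icc_right ht.2))
  exact intermediate_value_Icc ht.1 hc ⟨by simpa [h.start] using h1, h2⟩

theorem exists_add_eq (h : FrontFacts T ℓ₀ ℓ y q) {t s : ℝ} (ht : t ∈ Icc 0 T)
    (h1 : ℓ₀ ≤ s) (h2 : s ≤ t + ℓ t) : ∃ τ ∈ Icc 0 t, τ + ℓ τ = s := by
  have hc : ContinuousOn (fun t => t + ℓ t) (Icc 0 t) :=
    continuousOn_id.add (h.continuousOn.mono (Icc_subset_Icc_right ht.2))
  exact intermediate_value_Icc ht.1 hc ⟨by simpa [h.start] using h1, h2⟩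

end FrontFacts

theorem IsSolution.exists_frontFacts {κ : ℝ → ℝ} {T ℓ₀ : ℝ} {y₀ y₁ u ℓ : ℝ → ℝ} {y : ℝ → ℝ → ℝ}
    (h : IsSolution κ T ℓ₀ y₀ y₁ u ℓ y) (hℓ₀ : 0 < ℓ₀) {c₁ : ℝ} (hc₁ : 0 < c₁)
    (hκ : ∀ x, 0 ≤ x → c₁ ≤ κ x) : ∃ q, FrontFacts T ℓ₀ ℓ y q := by
  obtain ⟨q, hq, hslope⟩ := h.exists_front_slope hℓ₀ hc₁ hκ
  have hslow : SlowFront ℓ T := by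
    intro s hs t ht hst
    obtain ⟨h1, h2⟩ := hslope s hs t ht hst
    exact ⟨h1, by nlinarith⟩
  exact ⟨q, hq, h.front_lipschitz, hslope, h.front_initial, h.boundary_front,
    fun hab hbc hcd h0 hT hf => h.wave.parallelogram h.lipschitz hslow hab hbc hcd h0 hT hf⟩

theorem SplitUpTo.symm_form {T : ℝ} {ℓ : ℝ → ℝ} {y : ℝ → ℝ → ℝ} {f : ℝ → ℝ} {s : ℝ}
    (h : SplitUpTo T ℓ y f s) : ∀ t x t' x', (t, x) ∈ closedRegion T ℓ →
      (t', x') ∈ closedRegion T ℓ → t + x = t' + x' → t - x ≤ s → t' - x' ≤ s →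
      y t x - f (t - x) = y t' x' - f (t' - x') := by
  intro t x t' x' hm hm' he hs hs'
  rw [← charMem_sub_add] at hm hm'
  rw [← charVal_sub_add y t x, ← charVal_sub_add y t' x', ← he]
  rw [← he] at hm'
  rcases le_total (t - x) (t' - x') with hle | hle
  · exact h _ _ _ hm hm' hle hs'
  · exact (h _ _ _ hm' hm hle hs).symm

section uniqueness

variable {κ : ℝ → ℝ} {T ℓ₀ S c₁ q : ℝ} {y₀ y₁ u f g w ℓ : ℝ → ℝ} {y : ℝ → ℝ → ℝ}

theorem FrontProfile.strictMono (hP : FrontProfile κ ℓ₀ S f w) :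
    StrictMono fun s => s + w s := fun _ _ h => add_lt_add_of_lt_of_le h (hP.monotone_front h.le)

theorem Profile.le_final (hP : Profile κ T ℓ₀ y₀ y₁ S f g w) (hℓ₀ : 0 < ℓ₀) : ℓ₀ ≤ T := by
  have h1 := hP.monotone_front (show -ℓ₀ ≤ S by linarith [hP.nonneg])
  rw [hP.front_start] at h1
  linarith [hP.final, hP.nonneg]

/-- A split up to a characteristic determines the front up to there. -/
theorem front_eq_of_split (hc₁ : 0 < c₁) (hκ : ∀ x, 0 ≤ x → c₁ ≤ κ x)
    (hκL : LocallyLipschitzOn (Ici 0) κ) (hℓ₀ : 0 < ℓ₀)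
    (hP : Profile κ T ℓ₀ y₀ y₁ S f g w) (hsol : IsSolution κ T ℓ₀ y₀ y₁ u ℓ y)
    (hF : FrontFacts T ℓ₀ ℓ y q) {s : ℝ} (hsp : SplitUpTo T ℓ y f s) {t : ℝ} (ht : t ∈ Icc 0 T)
    (hts : t - ℓ t ≤ s) : ℓ t = w (t - ℓ t) := by
  obtain ⟨M, hM⟩ := hP.lipschitz_right
  obtain ⟨W, hW⟩ := hP.lipschitz_front
  have hdiff : ∀ᵐ z, DifferentiableAt ℝ f z := hM.ae_differentiableAt_real
  have hexp := expanding_of_slope hF.lt_one hF.slope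
  have hae := ae_comp_of_expanding hexp hdiff
  have main : ∀ τ ∈ Icc 0 T, τ - ℓ τ ≤ s → τ - ℓ τ ≤ S → ℓ τ = w (τ - ℓ τ) := by
    intro τ hτ hτs hτS
    have hsub : Icc 0 τ ⊆ Icc 0 T := Icc_subset_Icc_right hτ.2
    refine front_eq_of_flow hc₁ hκ hκL hM hW hP.monotone_front hℓ₀ hP.front_start hP.flow hτ.1
      ?_ hF.start hF.lt_one (fun a ha b hb => hF.slope a (hsub ha) b (hsub hb)) hτS ?_
    · obtain ⟨K, hK⟩ := hF.lipschitz
      exact ⟨K, hK.mono hsub⟩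
    · filter_upwards [hae, hsol.ae_griffith, hF.lipschitz.ae_differentiableAt] with r h1 h2 h3 hr
      have hrT : r ∈ Ioo 0 T := ⟨hr.1, hr.2.trans_le hτ.2⟩
      have hrc := Ioo_subset_Icc_self hrT
      obtain ⟨p, h4, h5, h6, h7⟩ := h2 hrT
      have hpos : 0 < ℓ r := hℓ₀.trans_le (hF.le_front hrc)
      have h8 := hasDerivWithinAt_front_relation hF.slowFront hpos hrT hF.zero hsp.symm_form
        ((hF.sub_strictMono hrc hτ hr.2).trans_le hτs) h4 (h3 hrT).hasDerivAt
        (h1 hrc).hasDerivAt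
      have hκpos : 0 < κ (ℓ r) := hc₁.trans_le (hκ _ hpos.le)
      have hv1 : deriv ℓ r < 1 := by
        by_contra hc
        push Not at hc
        have h9 : energyReleaseRate (deriv ℓ r) p ≤ 0 := by
          rw [energyReleaseRate]
          exact mul_nonpos_of_nonpos_of_nonneg (by nlinarith) (sq_nonneg p)
        nlinarith
      exact ⟨h5, flow_of_griffith hκpos h5 hv1 h8 h6 h7⟩
  rcases le_or_gt (t - ℓ t) S with h | h
  · exact main t ht hts h
  -- A front beyond `S` at time `t` would have crossed `S` at some `τ ≤ t`; but there `τ = S + w S =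
  -- T`, so `t = τ`.
  · exfalso
    obtain ⟨τ, hτ, hτS⟩ := hF.exists_sub_eq ht (by linarith [hP.nonneg]) h.le
    have hτT : τ ∈ Icc 0 T := ⟨hτ.1, hτ.2.trans ht.2⟩
    have := main τ hτT (by linarith) hτS.le
    rw [hτS] at this
    have h1 : τ = T := by linarith [hP.final]
    have h2 : t = τ := le_antisymm (h1 ▸ ht.2) hτ.2
    rw [h2] at h
    linarith

theorem mem_of_front_eq (hP : Profile κ T ℓ₀ y₀ y₁ S f g w) (hF : FrontFacts T ℓ₀ ℓ y q) {t : ℝ}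
    (ht : t ∈ Icc 0 T) (h : ℓ t = w (t - ℓ t)) : t - ℓ t ∈ Icc (-ℓ₀) S := by
  constructor
  · have h0 : (0 : ℝ) ∈ Icc 0 T := ⟨le_rfl, ht.1.trans ht.2⟩
    have := hF.sub_strictMono.monotoneOn h0 ht ht.1
    simpa [hF.start] using this
  · rw [← hP.strictMono.le_iff_le, ← h, hP.final]
    linarith [ht.2]

/-- A split up to a characteristic determines the solution up to there. -/
theorem eq_of_split (hc₁ : 0 < c₁) (hκ : ∀ x, 0 ≤ x → c₁ ≤ κ x)
    (hκL : LocallyLipschitzOn (Ici 0) κ) (hℓ₀ : 0 < ℓ₀)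
    (hP : Profile κ T ℓ₀ y₀ y₁ S f g w) (hsol : IsSolution κ T ℓ₀ y₀ y₁ u ℓ y)
    (hF : FrontFacts T ℓ₀ ℓ y q) {s : ℝ} (hsp : SplitUpTo T ℓ y f s) {ξ η : ℝ}
    (hm : CharMem T ℓ ξ η) (hξ : ξ ≤ s) : charVal y ξ η = f ξ + g η := by
  obtain ⟨h1, h2, h3, h4⟩ := id hm
  -- Followed backwards in time, the line `η = const` ends on the initial segment or on the front,
  -- according to whether `η ≤ ℓ₀`. In both cases `y` is known at the end point.
  rcases le_total η ℓ₀ with hη | hη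
  · have hm0 : CharMem T ℓ (-η) η :=
      hF.charMem_of_le (by linarith) (by linarith) (by linarith) (by linarith)
    have h5 := hsp (-η) ξ η hm0 hm (by linarith) hξ
    have h6 : charVal y (-η) η = y₀ η := by
      have := hsol.initial_position η ⟨by linarith, hη⟩
      rw [← this, charVal]
      congr 1 <;> ring
    have h7 := hP.initial_left η ⟨by linarith, hη⟩
    rw [h6, ← h7] at h5
    linarith
  · have ht : (ξ + η) / 2 ∈ Icc 0 T := ⟨by linarith, by linarith⟩
    obtain ⟨τ, hτ, hτη⟩ := hF.exists_add_eq ht hη (by linarith)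
    have hτT : τ ∈ Icc 0 T := ⟨hτ.1, hτ.2.trans ht.2⟩
    have hle : τ - ℓ τ ≤ ξ := by linarith [hτ.2]
    have hm0 : CharMem T ℓ (τ - ℓ τ) η := by
      rw [← hτη, charMem_sub_add]
      exact ⟨hτT.1, hτT.2, by linarith [hF.le_front hτT], le_rfl⟩
    have h5 := hsp _ ξ η hm0 hm hle hξ
    have h6 : charVal y (τ - ℓ τ) η = 0 := by
      rw [← hτη, charVal_sub_add, hF.zero τ hτT]
    have h7 := front_eq_of_split hc₁ hκ hκL hℓ₀ hP hsol hF hsp hτT (hle.trans hξ)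
    have h8 := hP.reflection _ (mem_of_front_eq hP hF hτT h7)
    rw [← h7, show τ - ℓ τ + 2 * ℓ τ = η by linarith] at h8
    rw [h6] at h5
    linarith

/-- Let `F` be the trace of `y` on the characteristic `η = ℓ₀`. In the triangle over `[0, ℓ₀]` the
parallelogram identity gives `y = y₀(η) + F(ξ) - F(-η)`; the time derivative at `t = 0` is `y₁ = y₀'
+ 2F'`, so `F' = f'` almost everywhere and `F - f` is constant. For `η > ℓ₀` one more parallelogram,
based on `η = ℓ₀`, suffices. -/
theorem split_initial (hℓ₀ : 0 < ℓ₀) (hy₀ : LipschitzIcc y₀ 0 ℓ₀)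
    (hP : Profile κ T ℓ₀ y₀ y₁ S f g w) (hsol : IsSolution κ T ℓ₀ y₀ y₁ u ℓ y)
    (hF : FrontFacts T ℓ₀ ℓ y q) : SplitUpTo T ℓ y f 0 := by
  have hT := hP.le_final hℓ₀
  set F : ℝ → ℝ := fun ξ => charVal y ξ ℓ₀ with hFdef
  have hFL : LipschitzIcc F (-ℓ₀) 0 := by
    obtain ⟨K, hK⟩ := hsol.lipschitz
    refine ⟨K, LipschitzOnWith.of_dist_le_mul fun a ha b hb => ?_⟩
    have hm : ∀ a ∈ Icc (-ℓ₀) 0, ((a + ℓ₀) / 2, (ℓ₀ - a) / 2) ∈ closedRegion T ℓ := by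
      intro a ha
      rw [← charMem_sub_add]
      have := hF.charMem_of_le (ξ := a) (η := ℓ₀) (by linarith [ha.1]) (by linarith [ha.2])
        (by linarith [ha.2]) (by linarith [ha.1])
      convert this using 1 <;> ring
    refine (hK.dist_le_mul _ (hm a ha) _ (hm b hb)).trans ?_
    gcongr
    rw [Prod.dist_eq]
    apply max_le
    · rw [Real.dist_eq, Real.dist_eq, show (a + ℓ₀) / 2 - (b + ℓ₀) / 2 = (a - b) / 2 by ring,
        abs_div, abs_two]
      linarith [abs_nonneg (a - b)]
    · rw [Real.dist_eq, Real.dist_eq, show (ℓ₀ - a) / 2 - (ℓ₀ - b) / 2 = -((a - b) / 2) by ring,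
        abs_neg, abs_div, abs_two]
      linarith [abs_nonneg (a - b)]
  have htri : ∀ ξ η, ξ ≤ 0 → -ξ ≤ η → η ≤ ℓ₀ → charVal y ξ η = y₀ η + F ξ - F (-η) := by
    intro ξ η h1 h2 h3
    have h4 : charVal y (-η) η = y₀ η := by
      have := hsol.initial_position η ⟨by linarith, h3⟩
      rw [← this, charVal]
      congr 1 <;> ring
    have hfr : (ℓ₀ - -η) / 2 ≤ ℓ ((-η + ℓ₀) / 2) := by
      have := hF.le_front (t := (-η + ℓ₀) / 2) ⟨by linarith, by linarith⟩
      linarith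
    have h5 := hF.parallelogram (a := -η) (b := ξ) (c := η) (d := ℓ₀) (by linarith) (by linarith)
      h3 (by linarith) (by linarith) hfr
    rw [h4] at h5
    simp only [hFdef]
    linarith
  have hFae : ∀ᵐ s, s ∈ Ioo (-ℓ₀) 0 → HasDerivAt F (deriv f s) s ∧ HasDerivAt f (deriv f s) s := by
    have hv := hsol.initial_velocity
    rw [ae_restrict_iff' measurableSet_Icc] at hv
    have hneg : ∀ᵐ s : ℝ, (-s ∈ Icc 0 ℓ₀ → HasDerivWithinAt (fun t => y t (-s)) (y₁ (-s))
        (Icc 0 T) 0) ∧ (-s ∈ Ioo 0 ℓ₀ → HasDerivAt f ((y₁ (-s) - deriv y₀ (-s)) / 2) (- -s)) ∧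
        (-s ∈ Ioo 0 ℓ₀ → DifferentiableAt ℝ y₀ (-s)) := by
      have h1 := (hv.and (hP.initial_right.and hy₀.ae_differentiableAt))
      exact (Measure.measurePreserving_neg (volume : Measure ℝ)).quasiMeasurePreserving.ae h1
    filter_upwards [hneg, hFL.ae_differentiableAt] with s ⟨h1, h2, h3⟩ h4 hs
    have hs' : -s ∈ Ioo 0 ℓ₀ := ⟨by linarith [hs.2], by linarith [hs.1]⟩
    have h5 := h1 (Ioo_subset_Icc_self hs')
    have h6 := h2 hs'
    rw [neg_neg] at h6
    have h7 := (h3 hs').hasDerivAt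
    have h8 := (h4 hs).hasDerivAt
    -- At `x = -s` the point `(t, x)` stays in the triangle as long as `t ≤ -s` and `t ≤ ℓ₀ + s`.
    have hA : Icc 0 (min T (min (-s) (ℓ₀ + s))) ⊆ Icc 0 T :=
      Icc_subset_Icc_right (min_le_left _ _)
    have hpos : 0 < min T (min (-s) (ℓ₀ + s)) := by
      apply lt_min (by linarith) (lt_min hs'.1 (by linarith [hs.1]))
    have h9 : HasDerivWithinAt (fun t => y₀ (t + -s) + F (t - -s) - F (-(t + -s)))
        (deriv y₀ (-s) + deriv F s + deriv F s) (Icc 0 (min T (min (-s) (ℓ₀ + s)))) 0 := by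
      have e1 : HasDerivAt (fun t => y₀ (t + -s)) (deriv y₀ (-s)) 0 := by
        apply HasDerivAt.comp_add_const
        simpa using h7
      have e2 : HasDerivAt (fun t => F (t - -s)) (deriv F s) 0 := by
        apply HasDerivAt.comp_sub_const
        simpa using h8
      have e3 : HasDerivAt (fun t => F (-(t + -s))) (-deriv F s) 0 := by
        have h8' : HasDerivAt F (deriv F s) (s - 0) := by simpa using h8
        have := h8'.comp_const_sub s 0
        refine this.congr_of_eventuallyEq (Filter.Eventually.of_forall fun t => ?_)
        simp only
        congr 1
        ring
      exact (((e1.fun_add e2).fun_sub e3).congr_deriv (by ring)).hasDerivWithinAt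
    have h10 := (h5.mono hA).congr (f₁ := fun t => y₀ (t + -s) + F (t - -s) - F (-(t + -s)))
      (by
        intro t ht
        have ht2 := ht.2.trans (min_le_right _ _)
        rw [← charVal_sub_add y t (-s), htri _ _ (by linarith [ht2.trans (min_le_left _ _)])
          (by linarith [ht.1]) (by linarith [ht2.trans (min_le_right _ _)])])
      (by
        rw [← charVal_sub_add y 0 (-s), htri _ _ (by linarith [hs.2]) (by linarith)
          (by linarith [hs.1])])
    have h11 := (uniqueDiffOn_Icc hpos 0 (left_mem_Icc.2 hpos.le)).eq_deriv _ h9 h10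
    rw [h6.deriv]
    refine ⟨h8.congr_deriv (by linarith), h6⟩
  have hFf : ∀ σ ∈ Icc (-ℓ₀) 0, F σ - f σ = F (-ℓ₀) - f (-ℓ₀) := by
    intro σ hσ
    obtain ⟨K, hK⟩ := hFL
    obtain ⟨M, hM⟩ := hP.lipschitz_right
    have hL : LipschitzIcc (fun s => F s - f s) (-ℓ₀) σ :=
      ⟨_, (hK.mono (Icc_subset_Icc_right hσ.2)).sub hM.lipschitzOnWith⟩
    have := sub_eq_integral_of_ae_hasDerivAt (g' := fun _ => 0) hσ.1
      (hL.absolutelyContinuous hσ.1) (by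
        filter_upwards [hFae] with s h1 hs
        obtain ⟨h2, h3⟩ := h1 ⟨hs.1, hs.2.trans_le hσ.2⟩
        exact (h2.fun_sub h3).congr_deriv (sub_self _))
    simp only [intervalIntegral.integral_zero] at this
    linarith
  intro ξ₁ ξ₂ η hm₁ hm₂ hle h0
  have hn := hF.neg_le_of_charMem hm₁
  have e1 := hFf ξ₁ ⟨hn, hle.trans h0⟩
  have e2 := hFf ξ₂ ⟨hn.trans hle, h0⟩
  rcases le_total η ℓ₀ with hη | hη
  · rw [htri ξ₁ η (hle.trans h0) (by linarith [hm₁.1]) hη,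
      htri ξ₂ η h0 (by linarith [hm₁.1]) hη]
    linarith
  · have := hF.parallelogram (a := ξ₁) (b := ξ₂) (c := ℓ₀) (d := η) hle (by linarith) hη
      (by linarith) hm₂.2.1 hm₁.2.2.2
    simp only [hFdef] at e1 e2
    linarith

/-- Two parallelograms with a corner on `x = 0`, where `y = u = f + g`. The first leads from the
line `ξ = s`, where `y` is known, to `(ξ₁, ξ₂)`; the second leads from there to any `η`. The step
`ℓ₀` is possible because the front never lies below `ℓ₀`, so the first rectangle stays in the
region. -/
theorem split_step (hc₁ : 0 < c₁) (hκ : ∀ x, 0 ≤ x → c₁ ≤ κ x)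
    (hκL : LocallyLipschitzOn (Ici 0) κ) (hℓ₀ : 0 < ℓ₀)
    (hP : Profile κ T ℓ₀ y₀ y₁ S f g w) (hu : ∀ t ∈ Icc 0 T, u t = f t + g t)
    (hsol : IsSolution κ T ℓ₀ y₀ y₁ u ℓ y)
    (hF : FrontFacts T ℓ₀ ℓ y q) {s : ℝ} (hs : 0 ≤ s) (hsp : SplitUpTo T ℓ y f s) :
    SplitUpTo T ℓ y f (s + ℓ₀) := by
  have hbd : ∀ t ∈ Icc 0 T, charVal y t t = f t + g t := by
    intro t ht
    rw [← hu t ht, ← hsol.boundary_left t ht, charVal]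
    congr 1 <;> ring
  have key : ∀ ξ₁ ξ₂ η, CharMem T ℓ ξ₁ η → CharMem T ℓ ξ₂ η → s ≤ ξ₁ → ξ₁ ≤ ξ₂ → ξ₂ ≤ s + ℓ₀ →
      charVal y ξ₁ η - f ξ₁ = charVal y ξ₂ η - f ξ₂ := by
    intro ξ₁ ξ₂ η hm₁ hm₂ h1 h2 h3
    have hT2 : ξ₂ ≤ T := by linarith [hm₂.2.1, hm₂.2.2.1]
    have hsm : ∀ η, s ≤ η → η ≤ ξ₂ → charVal y s η = f s + g η := fun η h4 h5 =>
      eq_of_split hc₁ hκ hκL hℓ₀ hP hsol hF hsp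
        (hF.charMem_of_le (by linarith) (by linarith) h4 (by linarith)) le_rfl
    have hfr : (ξ₂ - s) / 2 ≤ ℓ ((s + ξ₂) / 2) := by
      have := hF.le_front (t := (s + ξ₂) / 2) ⟨by linarith, by linarith⟩
      linarith
    have p1 := hF.parallelogram h1 le_rfl h2 (by linarith) (by linarith) hfr
    rw [hsm ξ₁ h1 h2, hsm ξ₂ (h1.trans h2) le_rfl, hbd ξ₁ ⟨by linarith, by linarith⟩] at p1
    have p2 := hF.parallelogram h2 le_rfl hm₂.2.2.1 (by linarith) hm₂.2.1 hm₁.2.2.2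
    rw [hbd ξ₂ ⟨by linarith, hT2⟩] at p2
    linarith
  intro ξ₁ ξ₂ η hm₁ hm₂ hle h2
  rcases le_total ξ₂ s with h | h
  · exact hsp ξ₁ ξ₂ η hm₁ hm₂ hle h
  · rcases le_total s ξ₁ with h' | h'
    · exact key ξ₁ ξ₂ η hm₁ hm₂ h' hle h2
    · have hms := hm₁.between hF.slowFront hm₂ h' h
      exact (hsp ξ₁ s η hm₁ hms h' le_rfl).trans (key s ξ₂ η hms hm₂ le_rfl h h2)

/-- Every solution for the control `u = f + g` is given by the profile. -/
theorem Profile.unique (hc₁ : 0 < c₁) (hκ : ∀ x, 0 ≤ x → c₁ ≤ κ x)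
    (hκL : LocallyLipschitzOn (Ici 0) κ) (hℓ₀ : 0 < ℓ₀) (hy₀ : LipschitzIcc y₀ 0 ℓ₀)
    (hP : Profile κ T ℓ₀ y₀ y₁ S f g w) (hu : ∀ t ∈ Icc 0 T, u t = f t + g t)
    (hsol : IsSolution κ T ℓ₀ y₀ y₁ u ℓ y) :
    (∀ t ∈ Icc 0 T, ℓ t = w (t - ℓ t)) ∧
      ∀ t x, (t, x) ∈ closedRegion T ℓ → y t x = f (t - x) + g (t + x) := by
  obtain ⟨q, hF⟩ := hsol.exists_frontFacts hℓ₀ hc₁ hκ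
  have hall : ∀ n : ℕ, SplitUpTo T ℓ y f (n * ℓ₀) := by
    intro n
    induction n with
    | zero => simpa using split_initial hℓ₀ hy₀ hP hsol hF
    | succ n ih =>
      have := split_step hc₁ hκ hκL hℓ₀ hP hu hsol hF (by positivity) ih
      rwa [Nat.cast_succ, add_mul, one_mul]
  -- Since `t - x ≤ T` on the region, finitely many strips cover it.
  obtain ⟨n, hn⟩ := exists_nat_ge (T / ℓ₀)
  rw [div_le_iff₀ hℓ₀] at hn
  constructor
  · intro t ht
    refine front_eq_of_split hc₁ hκ hκL hℓ₀ hP hsol hF (hall n) ht ?_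
    linarith [hF.le_front ht, ht.2]
  · intro t x hm
    rw [← charVal_sub_add y]
    obtain ⟨h1, h2, h3, h4⟩ := id hm
    simp only at h1 h2 h3 h4
    exact eq_of_split hc₁ hκ hκL hℓ₀ hP hsol hF (hall n) (charMem_sub_add.2 hm) (by linarith)

end uniqueness

/-! ### Existence -/

/-- Needed for `w` and for `2w`: the front crosses the characteristic `s` at time `s + w s`, and the
reflected wave then travels along `t + x = s + 2 w s`. -/
theorem exists_inverse_id_add {w : ℝ → ℝ} (hw : Continuous w) (hm : Monotone w) :
    ∃ ψ : ℝ → ℝ, (∀ t, ψ t + w (ψ t) = t) ∧ (∀ s, ψ (s + w s) = s) ∧ LipschitzWith 1 ψ ∧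
      Monotone ψ := by
  have hstrict : StrictMono fun s => s + w s := fun a b h => add_lt_add_of_lt_of_le h (hm h.le)
  have hex : ∀ t, ∃ s, s + w s = t := by
    intro t
    have hab : min (t - w 0) 0 ≤ max (t - w 0) 0 := (min_le_right _ _).trans (le_max_right _ _)
    have hc : ContinuousOn (fun s => s + w s) (Icc (min (t - w 0) 0) (max (t - w 0) 0)) := by
      fun_prop
    obtain ⟨s, -, hs⟩ := intermediate_value_Icc hab hc (show t ∈ Icc _ _ from ⟨by
        have h1 := hm (min_le_right (t - w 0) 0)
        have h2 := min_le_left (t - w 0) 0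
        linarith, by
        have h1 := hm (le_max_right (t - w 0) 0)
        have h2 := le_max_left (t - w 0) 0
        linarith⟩)
    exact ⟨s, hs⟩
  choose ψ hψ using hex
  have hmono : Monotone ψ := by
    intro a b hab
    by_contra hc
    push Not at hc
    have := hstrict hc
    simp only [hψ] at this
    linarith
  refine ⟨ψ, hψ, fun s => hstrict.injective (hψ _), ?_, hmono⟩
  have key : ∀ a b, a ≤ b → |ψ a - ψ b| ≤ |a - b| := by
    intro a b hab
    have h1 := hmono hab
    have h2 := hm h1
    rw [abs_sub_comm, abs_sub_comm a, abs_of_nonneg (by linarith), abs_of_nonneg (by linarith)]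
    linarith [hψ a, hψ b]
  apply LipschitzWith.of_dist_le_mul
  intro a b
  rw [Real.dist_eq, Real.dist_eq, NNReal.coe_one, one_mul]
  rcases le_total a b with h | h
  · exact key a b h
  · rw [abs_sub_comm, abs_sub_comm a]
    exact key b a h

theorem hasDerivAt_inverse_id_add {w ψ : ℝ → ℝ} {t h : ℝ} (hψ : ∀ t, ψ t + w (ψ t) = t)
    (hψL : LipschitzWith 1 ψ) (hh : 0 ≤ h) (hw : HasDerivAt w h (ψ t)) :
    HasDerivAt ψ (1 + h)⁻¹ t := by
  apply HasDerivAt.of_local_left_inverse hψL.continuous.continuousAt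
    ((hasDerivAt_id (ψ t)).fun_add hw) (by positivity)
  exact Filter.Eventually.of_forall hψ

section front

variable {κ : ℝ → ℝ} {ℓ₀ S : ℝ} {f w : ℝ → ℝ}

/-- The front is `w ∘ ψ`, with `ψ` the inverse of the crossing time `s + w s`. The rate `h` in `s`
becomes the speed `h/(1 + h)` in `t`, and expansion of `ψ` carries a.e. statements from `s` to `t`.
-/
theorem FrontProfile.exists_front (hP : FrontProfile κ ℓ₀ S f w) :
    ∃ ℓ : ℝ → ℝ, (∃ L : ℝ≥0, LipschitzWith L ℓ) ∧ (∀ t, ℓ t = w (t - ℓ t)) ∧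
      (∀ s, ℓ (s + w s) = w s) ∧ Monotone ℓ ∧ Monotone (fun t => t - ℓ t) ∧
      ∀ᵐ t, t ∈ Ioo 0 (S + w S) → t - ℓ t ∈ Ioo (-ℓ₀) S ∧
        HasDerivAt w (flowRate κ f (t - ℓ t) (ℓ t)) (t - ℓ t) ∧
        DifferentiableAt ℝ f (t - ℓ t) ∧
        HasDerivAt ℓ (flowRate κ f (t - ℓ t) (ℓ t) / (1 + flowRate κ f (t - ℓ t) (ℓ t))) t := by
  obtain ⟨W, hW⟩ := hP.lipschitz_front
  obtain ⟨M, hM⟩ := hP.lipschitz_right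
  obtain ⟨ψ, h1, h2, h3, h4⟩ := exists_inverse_id_add hW.continuous hP.monotone_front
  have e : ∀ t, t - w (ψ t) = ψ t := fun t => by linarith [h1 t]
  refine ⟨fun t => w (ψ t), ⟨_, hW.comp h3⟩, fun t => ?_, fun s => ?_,
    hP.monotone_front.comp h4, ?_, ?_⟩
  · simp only [e]
  · simp only [h2]
  · simpa only [e] using h4
  · simp only [e]
    have hexp : ∀ t ∈ (univ : Set ℝ), ∀ t' ∈ (univ : Set ℝ),
        |t - t'| ≤ (1 + W : ℝ≥0) * |ψ t - ψ t'| := by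
      intro t _ t' _
      have h5 := hW.dist_le_mul (ψ t) (ψ t')
      rw [Real.dist_eq, Real.dist_eq] at h5
      have h6 : t - t' = (ψ t - ψ t') + (w (ψ t) - w (ψ t')) := by linarith [h1 t, h1 t']
      rw [h6]
      refine (abs_add_le _ _).trans ?_
      push_cast
      linarith
    have hae := ae_comp_of_expanding hexp (hP.flow.and hM.ae_differentiableAt_real)
    filter_upwards [hae] with t ht htm
    obtain ⟨h5, h6⟩ := ht (mem_univ t)
    have hs : ψ t ∈ Ioo (-ℓ₀) S := by
      constructor
      · rw [← hP.strictMono.lt_iff_lt]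
        simp only [h1, hP.front_start]
        linarith [htm.1]
      · rw [← hP.strictMono.lt_iff_lt]
        simp only [h1]
        exact htm.2
    have h7 := h5 hs
    have hr := flowRate_nonneg κ f (ψ t) (w (ψ t))
    refine ⟨hs, h7, h6, ?_⟩
    have h8 := hasDerivAt_inverse_id_add h1 h3 hr h7
    have h9 := (h7.comp t h8)
    rw [div_eq_mul_inv]
    exact h9

/-- Converse of `flow_of_griffith`: here the energy release rate is `2F²/(1 + 2h)`, at most `k` by
the choice of `h`, and equal to `k` when `h > 0`. -/
theorem griffith_of_flow {k F h v p : ℝ} (hk : 0 < k) (hh : h = max (F ^ 2 / k - 1 / 2) 0)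
    (hv : v = h / (1 + h)) (hp : p = -F - F * (1 + 2 * h)⁻¹) :
    0 ≤ v ∧ energyReleaseRate v p ≤ k ∧ v * (energyReleaseRate v p - k) = 0 := by
  have h0 : 0 ≤ h := hh ▸ le_max_right _ _
  have hE : energyReleaseRate v p = 2 * F ^ 2 / (1 + 2 * h) := by
    rw [energyReleaseRate, hv, hp]
    have : 1 + h ≠ 0 := by positivity
    have : 1 + 2 * h ≠ 0 := by positivity
    field_simp
    ring
  rw [hE]
  refine ⟨by rw [hv]; positivity, ?_, ?_⟩
  · rw [div_le_iff₀ (by positivity)]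
    have h1 : F ^ 2 / k - 1 / 2 ≤ h := hh ▸ le_max_left _ _
    have h2 : F ^ 2 / k ≤ h + 1 / 2 := by linarith
    rw [div_le_iff₀ hk] at h2
    linarith
  · rcases le_total (F ^ 2 / k - 1 / 2) 0 with h1 | h1
    · rw [max_eq_right h1] at hh
      rw [hv, hh]
      simp
    · rw [max_eq_left h1] at hh
      have : 1 + 2 * h = 2 * F ^ 2 / k := by rw [hh]; ring
      have hF : F ^ 2 ≠ 0 := by
        intro hF
        rw [hF, zero_div] at h1
        linarith
      rw [this, div_div_cancel₀ (by positivity), sub_self, mul_zero]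

end front

theorem Profile.exists_solution {κ : ℝ → ℝ} {T ℓ₀ S c₁ : ℝ} {y₀ y₁ f g w : ℝ → ℝ}
    (hc₁ : 0 < c₁) (hκ : ∀ x, 0 ≤ x → c₁ ≤ κ x) (hℓ₀ : 0 < ℓ₀) (hy₀ : LipschitzIcc y₀ 0 ℓ₀)
    (hP : Profile κ T ℓ₀ y₀ y₁ S f g w) :
    ∃ (ℓ : ℝ → ℝ) (y : ℝ → ℝ → ℝ), IsSolution κ T ℓ₀ y₀ y₁ (fun t => f t + g t) ℓ y := by
  obtain ⟨M, hM⟩ := hP.lipschitz_right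
  obtain ⟨N, hN⟩ := hP.lipschitz_left
  obtain ⟨W, hW⟩ := hP.lipschitz_front
  obtain ⟨ℓ, ⟨L, hL⟩, hℓw, hwℓ, hℓm, hsm, hae⟩ := hP.exists_front
  rw [hP.final] at hae
  have hℓ0 : ℓ 0 = ℓ₀ := by
    have := hwℓ (-ℓ₀)
    rwa [hP.front_start, neg_add_cancel] at this
  have hℓT : T - ℓ T = S := by
    have := hwℓ S
    rw [hP.final] at this
    rw [this]
    linarith [hP.final]
  have hmem : ∀ t ∈ Icc 0 T, t - ℓ t ∈ Icc (-ℓ₀) S := fun t ht =>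
    ⟨by simpa [hℓ0] using hsm ht.1, by simpa [hℓT] using hsm ht.2⟩
  have hpos : ∀ t ∈ Icc 0 T, 0 < ℓ t := fun t ht => by
    have := hℓm ht.1
    rw [hℓ0] at this
    linarith
  have hrefl : ∀ t ∈ Icc 0 T, g (t + ℓ t) = -f (t - ℓ t) := fun t ht => by
    rw [← hP.reflection _ (hmem t ht), ← hℓw]
    congr 1
    ring
  refine ⟨ℓ, fun t x => f (t - x) + g (t + x), ⟨L, hL.lipschitzOnWith⟩, ?_,
    weakWave_travelling T ℓ hM.continuous hN.continuous, ?_, ?_, ?_, ?_, hℓ0, ?_⟩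
  · exact ⟨_, ((hM.comp (LipschitzWith.prod_fst.sub LipschitzWith.prod_snd)).add
      (hN.comp (LipschitzWith.prod_fst.add LipschitzWith.prod_snd))).lipschitzOnWith⟩
  · intro t _
    simp
  · intro t ht
    simp [hrefl t ht]
  · intro x hx
    simp [hP.initial_left x hx]
  · rw [ae_restrict_iff' measurableSet_Icc]
    have ha : ∀ᵐ x : ℝ, x ≠ 0 := by simp [ae_iff]
    have hb : ∀ᵐ x : ℝ, x ≠ ℓ₀ := by simp [ae_iff]
    filter_upwards [ha, hb, hP.initial_right, hy₀.ae_differentiableAt] with x h1 h2 h3 h4 hx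
    have hxm : x ∈ Ioo 0 ℓ₀ := ⟨lt_of_le_of_ne hx.1 h1.symm, lt_of_le_of_ne hx.2 h2⟩
    have h5 := h3 hxm
    have h6 := (h4 hxm).hasDerivAt
    have h7 : HasDerivAt (fun z => f (-z)) (-((y₁ x - deriv y₀ x) / 2)) x := by
      simpa [Function.comp_def] using h5.comp x (hasDerivAt_neg x)
    have h8 : HasDerivAt g (deriv y₀ x - -((y₁ x - deriv y₀ x) / 2)) x := by
      refine (h6.fun_sub h7).congr_of_eventuallyEq ?_
      filter_upwards [Icc_mem_nhds hxm.1 hxm.2] with z hz using hP.initial_left z hz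
    have h9 : HasDerivAt (fun t => f (t - x)) ((y₁ x - deriv y₀ x) / 2) 0 := by
      apply HasDerivAt.comp_sub_const
      simpa using h5
    have h10 : HasDerivAt (fun t => g (t + x)) (deriv y₀ x - -((y₁ x - deriv y₀ x) / 2)) 0 := by
      apply HasDerivAt.comp_add_const
      simpa using h8
    exact ((h9.fun_add h10).congr_deriv (by ring)).hasDerivWithinAt
  · rw [Griffith, ae_restrict_iff' measurableSet_Icc]
    have ha : ∀ᵐ x : ℝ, x ≠ 0 := by simp [ae_iff]
    have hb : ∀ᵐ x : ℝ, x ≠ T := by simp [ae_iff]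
    -- With `μ` inverse to `s ↦ s + 2 w s`, the reflection law reads `g = -f ∘ μ` near the front,
    -- and this supplies the derivative of `g`.
    obtain ⟨μ, m1, m2, m3, m4⟩ := exists_inverse_id_add (w := fun s => 2 * w s)
      (hW.continuous.const_mul 2) (hP.monotone_front.const_mul zero_le_two)
    filter_upwards [ha, hb, hae] with t h1 h2 h3 ht
    obtain ⟨h4, h5, h6, h7⟩ := h3 ⟨lt_of_le_of_ne ht.1 h1.symm, lt_of_le_of_ne ht.2 h2⟩
    set s := t - ℓ t with hs
    set h := flowRate κ f s (ℓ t) with hh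
    have h0 : 0 ≤ h := flowRate_nonneg _ _ _ _
    have hη : t + ℓ t = s + 2 * w s := by rw [hs, ← hℓw]; ring
    have hμs : μ (t + ℓ t) = s := by rw [hη]; exact m2 s
    have hμd : HasDerivAt μ (1 + 2 * h)⁻¹ (t + ℓ t) := by
      apply hasDerivAt_inverse_id_add (w := fun s => 2 * w s) m1 m3 (by positivity)
      rw [hμs]
      exact h5.const_mul 2
    have hg : HasDerivAt g (-(deriv f s * (1 + 2 * h)⁻¹)) (t + ℓ t) := by
      have hf : HasDerivAt f (deriv f s) (μ (t + ℓ t)) := by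
        rw [hμs]
        exact h6.hasDerivAt
      refine (hf.comp (t + ℓ t) hμd).fun_neg.congr_of_eventuallyEq ?_
      have hev : ∀ᶠ η in nhds (t + ℓ t), μ η ∈ Ioo (-ℓ₀) S :=
        m3.continuous.continuousAt.eventually (hμs ▸ Ioo_mem_nhds h4.1 h4.2)
      filter_upwards [hev] with η hη
      have := hP.reflection _ (Ioo_subset_Icc_self hη)
      rw [m1 η] at this
      exact this
    have hp : HasDerivAt (fun x => f (t - x) + g (t + x))
        (-deriv f s - deriv f s * (1 + 2 * h)⁻¹) (ℓ t) :=
      ((h6.hasDerivAt.comp_const_sub t (ℓ t)).fun_add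
        (hg.comp_const_add t (ℓ t))).congr_deriv (by ring)
    exact ⟨_, hp.hasDerivWithinAt,
      griffith_of_flow (hc₁.trans_le (hκ _ (hpos t ht).le)) hh h7.deriv rfl⟩

/-! ### The initial branch -/

theorem initial_speed_eq {F k h : ℝ} (hk : 0 < k) (hh : h = max (F ^ 2 / k - 1 / 2) 0) :
    h / (1 + h) = max ((2 * F ^ 2 - k) / (2 * F ^ 2 + k)) 0 := by
  have hpos : 0 < 2 * F ^ 2 + k := by positivity
  rcases le_total (F ^ 2 / k - 1 / 2) 0 with h1 | h1
  · have h2 : F ^ 2 / k ≤ 1 / 2 := by linarith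
    rw [div_le_iff₀ hk] at h2
    rw [hh, max_eq_right h1, max_eq_right]
    · simp
    · exact div_nonpos_of_nonpos_of_nonneg (by linarith) hpos.le
  · have h2 : 1 / 2 ≤ F ^ 2 / k := by linarith
    rw [le_div_iff₀ hk] at h2
    rw [hh, max_eq_left h1, max_eq_left]
    · have : 1 + (F ^ 2 / k - 1 / 2) = (2 * F ^ 2 + k) / (2 * k) := by field_simp; ring
      rw [this]
      field_simp
    · exact div_nonneg (by linarith) hpos.le

theorem initial_speed_lt_one {F k : ℝ} (hk : 0 < k) :
    max ((2 * F ^ 2 - k) / (2 * F ^ 2 + k)) 0 < 1 := by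
  apply max_lt _ one_pos
  rw [div_lt_one (by positivity)]
  linarith

theorem initial_speed_le {F k c B : ℝ} (hc : 0 < c) (hk : c ≤ k) (hF : F ^ 2 ≤ B) :
    max ((2 * F ^ 2 - k) / (2 * F ^ 2 + k)) 0 ≤ max ((2 * B - c) / (2 * B + c)) 0 := by
  have hB : 0 ≤ B := (sq_nonneg F).trans hF
  have hk0 : 0 < k := hc.trans_le hk
  refine max_le_max ?_ le_rfl
  rw [div_le_div_iff₀ (by positivity) (by positivity)]
  nlinarith [mul_le_mul hF hk hc.le hB]

theorem deriv_eq_of_eqOn_Icc {f f' : ℝ → ℝ} {a b s : ℝ} (h : EqOn f f' (Icc a b))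
    (hs : s ∈ Ioo a b) : deriv f s = deriv f' s := by
  apply Filter.EventuallyEq.deriv_eq
  filter_upwards [Icc_mem_nhds hs.1 hs.2] with z hz using h hz

/-- The evolution of the initial branch is the flow rule written in time (`initial_speed_eq`). By
uniqueness every branch ends on `x = w s` at `s = 0`, and the front built from `w` is a branch; the
infimum is thus over a singleton, not the default value on the empty set. -/
theorem FrontProfile.initialFront_eq {κ : ℝ → ℝ} {ℓ₀ c₁ : ℝ} {y₀ y₁ f w : ℝ → ℝ}
    (hc₁ : 0 < c₁) (hκ : ∀ x, 0 ≤ x → c₁ ≤ κ x) (hκL : LocallyLipschitzOn (Ici 0) κ)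
    (hℓ₀ : 0 < ℓ₀) (hP : FrontProfile κ ℓ₀ 0 f w)
    (hf : EqOn f (initialProfile y₀ y₁) (Icc (-ℓ₀) 0)) :
    initialFront κ ℓ₀ y₀ y₁ = w 0 := by
  have hset : {lS : ℝ | ∃ (tS : ℝ) (ℓ : ℝ → ℝ), IsInitialBranch κ ℓ₀ y₀ y₁ tS ℓ ∧ ℓ tS = lS} =
      {w 0} := by
    apply Subset.antisymm
    · rintro _ ⟨τ, ℓ, hB, rfl⟩
      obtain ⟨M, hM⟩ := hP.lipschitz_right
      obtain ⟨W, hW⟩ := hP.lipschitz_front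
      have hev : ∀ᵐ t, t ∈ Ioo 0 τ → deriv ℓ t =
          max ((2 * deriv (initialProfile y₀ y₁) (t - ℓ t) ^ 2 - κ (ℓ t)) /
            (2 * deriv (initialProfile y₀ y₁) (t - ℓ t) ^ 2 + κ (ℓ t))) 0 := by
        have := hB.evolution
        rw [ae_restrict_iff' measurableSet_Icc] at this
        filter_upwards [this] with t ht htm using ht (Ioo_subset_Icc_self htm)
      have h0m : (0 : ℝ) ∈ Icc 0 τ := left_mem_Icc.2 hB.pos.le
      have hτm : τ ∈ Icc 0 τ := right_mem_Icc.2 hB.pos.le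
      have hge : ∀ t ∈ Icc 0 τ, ℓ₀ ≤ ℓ t := by
        intro t ht
        have hl : LipschitzIcc ℓ 0 t := by
          obtain ⟨K, hK⟩ := hB.lipschitz
          exact ⟨K, hK.mono (Icc_subset_Icc_right ht.2)⟩
        have := sub_nonneg_of_ae_hasDerivAt (g' := deriv ℓ) ht.1 (hl.absolutelyContinuous ht.1)
          (by
            filter_upwards [hl.ae_differentiableAt, hev] with s h1 h2 hs
            refine ⟨(h1 hs).hasDerivAt, ?_⟩
            rw [h2 ⟨hs.1, hs.2.trans_le ht.2⟩]
            exact le_max_right _ _)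
        rw [hB.start] at this
        linarith
      have hκpos : ∀ t ∈ Icc 0 τ, c₁ ≤ κ (ℓ t) := fun t ht => hκ _ (hℓ₀.le.trans (hge t ht))
      -- A crude bound `1` on the speed first confines `t - ℓ t` to `[-ℓ₀, 0]`, where the derivative
      -- of the profile is bounded; only then is a bound below `1` available.
      have hslope1 := lipschitzIcc_of_ae_deriv (q := 1) hB.lipschitz (by
        filter_upwards [hev] with t h1 ht
        rw [h1 ht]
        exact ⟨le_max_right _ _,
          (initial_speed_lt_one (hc₁.trans_le (hκpos t (Ioo_subset_Icc_self ht)))).le⟩)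
      have hrange : ∀ t ∈ Icc 0 τ, t - ℓ t ∈ Icc (-ℓ₀) 0 := by
        intro t ht
        have h1 := (hslope1 0 h0m t ht ht.1).2
        have h2 := (hslope1 t ht τ hτm ht.2).2
        rw [hB.start] at h1
        rw [hB.finish] at h2
        exact ⟨by linarith, by linarith⟩
      set I := initialProfile y₀ y₁ with hI
      -- At the two end points `f` and `I` agree on one side only, so their derivatives may differ
      -- there; the values for `I` are added by hand.
      set B : ℝ := (M : ℝ) ^ 2 + deriv I (-ℓ₀) ^ 2 + deriv I 0 ^ 2 with hBdef
      have hbound : ∀ s ∈ Icc (-ℓ₀) 0, deriv I s ^ 2 ≤ B := by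
        intro s hs
        rcases hs.1.eq_or_lt with h1 | h1
        · rw [← h1]
          linarith [sq_nonneg (M : ℝ), sq_nonneg (deriv I 0)]
        · rcases hs.2.eq_or_lt with h2 | h2
          · rw [h2]
            linarith [sq_nonneg (M : ℝ), sq_nonneg (deriv I (-ℓ₀))]
          · rw [← deriv_eq_of_eqOn_Icc hf ⟨h1, h2⟩]
            linarith [sq_deriv_le hM s, sq_nonneg (deriv I 0), sq_nonneg (deriv I (-ℓ₀))]
      have hB0 : 0 ≤ B := by positivity
      have hq : max ((2 * B - c₁) / (2 * B + c₁)) 0 < 1 := by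
        apply max_lt _ one_pos
        rw [div_lt_one (by positivity)]
        linarith
      have hslope := lipschitzIcc_of_ae_deriv hB.lipschitz (by
        filter_upwards [hev] with t h1 ht
        rw [h1 ht]
        have htc := Ioo_subset_Icc_self ht
        exact ⟨le_max_right _ _, initial_speed_le hc₁ (hκpos t htc) (hbound _ (hrange t htc))⟩)
      have h1 := front_eq_of_flow hc₁ hκ hκL hM hW hP.monotone_front hℓ₀ hP.front_start hP.flow
        hB.pos.le hB.lipschitz hB.start hq hslope (hrange τ hτm).2 (by
          filter_upwards [hev] with t h1 ht
          have htc := Ioo_subset_Icc_self ht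
          have hs : t - ℓ t ∈ Ioo (-ℓ₀) 0 := by
            have h2 := (hslope 0 h0m t htc ht.1.le).2
            have h3 := (hslope t htc τ hτm ht.2.le).2
            rw [hB.start] at h2
            rw [hB.finish] at h3
            constructor
            · nlinarith [ht.1]
            · nlinarith [ht.2]
          have h2 := h1 ht
          rw [← deriv_eq_of_eqOn_Icc hf hs] at h2
          have h3 := initial_speed_eq (h := flowRate κ f (t - ℓ t) (ℓ t))
            (hc₁.trans_le (hκpos t htc)) rfl
          rw [← h3] at h2
          have h4 := flowRate_nonneg κ f (t - ℓ t) (ℓ t)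
          rw [h2]
          refine ⟨by positivity, ?_⟩
          field_simp
          ring)
      rw [hB.finish, sub_self] at h1
      rw [mem_singleton_iff, hB.finish]
      exact h1
    · rintro _ rfl
      obtain ⟨ℓ, ⟨L, hL⟩, hℓw, hwℓ, hℓm, hsm, hae⟩ := hP.exists_front
      have hw0 : ℓ₀ ≤ w 0 := by
        have := hP.monotone_front (show -ℓ₀ ≤ 0 by linarith)
        rwa [hP.front_start] at this
      have h0 : ℓ (w 0) = w 0 := by simpa using hwℓ 0
      have hℓ0 : ℓ 0 = ℓ₀ := by
        have := hwℓ (-ℓ₀)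
        rwa [hP.front_start, neg_add_cancel] at this
      refine ⟨w 0, ℓ, ⟨by linarith, ⟨L, hL.lipschitzOnWith⟩, hℓ0, ?_, h0⟩, h0⟩
      rw [ae_restrict_iff' measurableSet_Icc]
      have ha : ∀ᵐ x : ℝ, x ≠ 0 := by simp [ae_iff]
      have hb : ∀ᵐ x : ℝ, x ≠ w 0 := by simp [ae_iff]
      rw [zero_add] at hae
      filter_upwards [ha, hb, hae] with t h1 h2 h3 ht
      obtain ⟨h4, -, -, h7⟩ := h3 ⟨lt_of_le_of_ne ht.1 h1.symm, lt_of_le_of_ne ht.2 h2⟩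
      rw [h7.deriv, ← deriv_eq_of_eqOn_Icc hf h4]
      have := hℓm ht.1
      rw [hℓ0] at this
      exact initial_speed_eq (hc₁.trans_le (hκ _ (by linarith))) rfl
  rw [initialFront, hset, csInf_singleton]

/-! ### Construction of the profile -/

theorem hasDerivAt_comp_clamp {g : ℝ → ℝ} {a b d s : ℝ} (hs : s ∈ Ioo a b)
    (h : HasDerivAt g d s) : HasDerivAt (fun s => g (clamp a b s)) d s := by
  refine h.congr_of_eventuallyEq ?_
  filter_upwards [Icc_mem_nhds hs.1 hs.2] with z hz
  rw [clamp_of_mem hz]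

theorem continuous_comp_clamp {κ : ℝ → ℝ} (hκL : LocallyLipschitzOn (Ici 0) κ) {R : ℝ}
    (hR : 0 ≤ R) : Continuous fun x => κ (clamp 0 R x) :=
  hκL.continuousOn.comp_continuous (lipschitzWith_clamp 0 R).continuous
    fun x => (clamp_mem hR x).1

theorem _root_.Measurable.of_uncurry_comp {H : ℝ → ℝ → ℝ} {w : ℝ → ℝ}
    (hH : Measurable (Function.uncurry H)) (hw : Measurable w) : Measurable fun σ => H σ (w σ) :=
  hH.comp (measurable_id.prodMk hw)

theorem exists_initial_frontProfile {κ f : ℝ → ℝ} {ℓ₀ c₁ : ℝ} (hc₁ : 0 < c₁)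
    (hκ : ∀ x, 0 ≤ x → c₁ ≤ κ x) (hκL : LocallyLipschitzOn (Ici 0) κ) (hℓ₀ : 0 < ℓ₀)
    (hf : ∃ M : ℝ≥0, LipschitzWith M f) :
    ∃ w : ℝ → ℝ, FrontProfile κ ℓ₀ 0 f w ∧ ∀ s, 0 ≤ s → w s = w 0 := by
  obtain ⟨M, hM⟩ := hf
  set B : ℝ := (M : ℝ) ^ 2 / c₁ with hB
  have hB0 : 0 ≤ B := by positivity
  -- A priori bound: the rate is at most `B` on an interval of length `ℓ₀`. Hence the cut-off of `κ`
  -- at `R`, which makes `H` globally Lipschitz, is never active.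
  set R : ℝ := ℓ₀ + B * ℓ₀ with hRdef
  have hR : 0 ≤ R := by positivity
  obtain ⟨C, hC⟩ := exists_flowRate_lipschitz hc₁ hκ hκL hM R
  set H : ℝ → ℝ → ℝ := fun s x => flowRate κ f s (clamp 0 R x) with hH
  have hHn : ∀ s x, 0 ≤ H s x := fun s x => flowRate_nonneg _ _ _ _
  have hHle : ∀ s x, H s x ≤ B := fun s x =>
    flowRate_le hc₁ hM (hκ _ (clamp_mem hR x).1) s
  have hHabs : ∀ s x, |H s x| ≤ B := fun s x => by
    rw [abs_of_nonneg (hHn s x)]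
    exact hHle s x
  have hm : Measurable (Function.uncurry H) := by
    have h1 : Measurable fun p : ℝ × ℝ => deriv f p.1 := (measurable_deriv f).comp measurable_fst
    have h2 : Measurable fun p : ℝ × ℝ => κ (clamp 0 R p.2) :=
      (continuous_comp_clamp hκL hR).measurable.comp measurable_snd
    exact (((h1.pow_const 2).div h2).sub_const _).max measurable_const
  have hK : ∀ s, LipschitzWith C (H s) := by
    intro s
    apply LipschitzWith.of_dist_le_mul
    intro x x'
    rw [Real.dist_eq]
    have h1 : |H s x - H s x'| ≤ C * |clamp 0 R x - clamp 0 R x'| :=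
      hC s _ (clamp_mem hR x) _ (clamp_mem hR x')
    refine h1.trans ?_
    gcongr
    rw [← Real.dist_eq]
    simpa using (lipschitzWith_clamp 0 R).dist_le_mul x x'
  have hab : -ℓ₀ ≤ 0 := by linarith
  obtain ⟨w₀, hw₀c, hw₀⟩ := exists_caratheodory hm hHabs hK hab ℓ₀
  have hmeas : Measurable fun σ => H σ (w₀ σ) := hm.of_uncurry_comp hw₀c.measurable
  have hint : ∀ a b, IntervalIntegrable (fun σ => H σ (w₀ σ)) volume a b :=
    intervalIntegrable_of_abs_le hmeas fun σ => hHabs σ _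
  have hsub : ∀ s ∈ Icc (-ℓ₀) 0, ∀ t ∈ Icc (-ℓ₀) 0, w₀ t - w₀ s = ∫ σ in s..t, H σ (w₀ σ) := by
    intro s hs t ht
    rw [hw₀ s hs, hw₀ t ht, add_sub_add_left_eq_sub,
      intervalIntegral.integral_interval_sub_left (hint _ _) (hint _ _)]
  have hmono : ∀ s ∈ Icc (-ℓ₀) 0, ∀ t ∈ Icc (-ℓ₀) 0, s ≤ t → w₀ s ≤ w₀ t := by
    intro s hs t ht hst
    have := intervalIntegral.integral_nonneg (μ := volume) hst fun σ _ => hHn σ (w₀ σ)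
    linarith [hsub s hs t ht]
  have hlip : ∀ s ∈ Icc (-ℓ₀) 0, ∀ t ∈ Icc (-ℓ₀) 0, |w₀ t - w₀ s| ≤ B * |t - s| := by
    intro s hs t ht
    rw [hsub s hs t ht]
    rw [← Real.norm_eq_abs]
    apply intervalIntegral.norm_integral_le_of_norm_le_const
    intro σ _
    exact hHabs σ (w₀ σ)
  have hstart : w₀ (-ℓ₀) = ℓ₀ := by
    rw [hw₀ _ (left_mem_Icc.2 hab)]
    simp
  have hrange : ∀ s ∈ Icc (-ℓ₀) 0, w₀ s ∈ Icc 0 R := by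
    intro s hs
    have h1 := hmono _ (left_mem_Icc.2 hab) s hs hs.1
    have h2 := (le_abs_self _).trans (hlip _ (left_mem_Icc.2 hab) s hs)
    rw [hstart] at h1 h2
    refine ⟨by linarith, ?_⟩
    have h3 : |s - -ℓ₀| ≤ ℓ₀ := by
      rw [abs_of_nonneg (by linarith [hs.1])]
      linarith [hs.2]
    have := mul_le_mul_of_nonneg_left h3 hB0
    linarith
  have hLip : LipschitzIcc w₀ (-ℓ₀) 0 := ⟨⟨B, hB0⟩, LipschitzOnWith.of_dist_le_mul
    fun s hs t ht => hlip t ht s hs⟩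
  have hLip' := hLip.comp_clamp hab
  refine ⟨fun s => w₀ (clamp (-ℓ₀) 0 s), ⟨⟨M, hM⟩, hLip', ?_, ?_, ?_, le_refl 0⟩, ?_⟩
  · intro s t hst
    exact hmono _ (clamp_mem hab s) _ (clamp_mem hab t) (monotone_clamp _ _ hst)
  · simp only [clamp_of_le hab le_rfl, hstart]
  · filter_upwards [(hint (-ℓ₀) 0).ae_hasDerivAt_integral] with s h1 hs
    have hsc := Ioo_subset_Icc_self hs
    have h2 := (h1 (by rwa [uIcc_of_le hab]) (-ℓ₀) (by simp)).const_add ℓ₀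
    rw [clamp_of_mem hsc]
    have e : flowRate κ f s (w₀ s) = H s (w₀ s) := by
      simp only [hH, clamp_of_mem (hrange s hsc)]
    rw [e]
    apply hasDerivAt_comp_clamp hs
    refine h2.congr_of_eventuallyEq ?_
    filter_upwards [Icc_mem_nhds hs.1 hs.2] with z hz using hw₀ z hz
  · intro s hs
    simp only [clamp_of_ge hab hs, clamp_of_ge hab le_rfl]

/-- The initial profile `½ ∫₀^{-s} (y₀' - y₁)`, continued by constants. -/
def initialRight (ℓ₀ : ℝ) (y₀ y₁ : ℝ → ℝ) (s : ℝ) : ℝ :=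
  (fun x => (y₀ x - y₀ 0 - ∫ σ in (0 : ℝ)..x, y₁ σ) / 2) (clamp 0 ℓ₀ (-s))

section initialRight

variable {ℓ₀ : ℝ} {y₀ y₁ : ℝ → ℝ}

theorem exists_lipschitzWith_initialRight (hℓ₀ : 0 < ℓ₀) (hy₀ : LipschitzIcc y₀ 0 ℓ₀)
    (hy₁ : MemLp y₁ ∞ (volume.restrict (Icc 0 ℓ₀))) :
    ∃ M : ℝ≥0, LipschitzWith M (initialRight ℓ₀ y₀ y₁) := by
  have h : LipschitzIcc (fun x => (y₀ x - y₀ 0 - ∫ σ in (0 : ℝ)..x, y₁ σ) / 2) 0 ℓ₀ := by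
    obtain ⟨K, hK⟩ := hy₀
    obtain ⟨L, hL⟩ := lipschitzIcc_primitive hy₁
    have h1 : LipschitzWith ‖(1 / 2 : ℝ)‖₊ fun x : ℝ => 1 / 2 * x := by
      apply LipschitzWith.of_dist_le_mul
      intro x y
      simp [Real.dist_eq, ← mul_sub, abs_mul]
    have h2 := h1.comp_lipschitzOnWith ((hK.sub ((LipschitzWith.const (y₀ 0)).lipschitzOnWith)).sub hL)
    have e : (fun x => (y₀ x - y₀ 0 - ∫ σ in (0 : ℝ)..x, y₁ σ) / 2) =
        (fun x : ℝ => 1 / 2 * x) ∘ fun x => y₀ x - y₀ 0 - ∫ σ in (0 : ℝ)..x, y₁ σ := by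
      funext x
      simp only [Function.comp_apply]
      ring
    rw [e]
    exact ⟨_, h2⟩
  obtain ⟨K, hK⟩ := h.comp_clamp hℓ₀.le
  exact ⟨_, hK.comp LipschitzWith.id.neg⟩

theorem initialRight_of_nonneg (hℓ₀ : 0 < ℓ₀) {s : ℝ} (hs : 0 ≤ s) :
    initialRight ℓ₀ y₀ y₁ s = 0 := by
  simp [initialRight, clamp_of_le hℓ₀.le (show -s ≤ 0 by linarith)]

theorem initialRight_eqOn (hy₀ : LipschitzIcc y₀ 0 ℓ₀)
    (hy₁ : MemLp y₁ ∞ (volume.restrict (Icc 0 ℓ₀))) :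
    EqOn (initialRight ℓ₀ y₀ y₁) (initialProfile y₀ y₁) (Icc (-ℓ₀) 0) := by
  intro s hs
  have hs' : -s ∈ Icc 0 ℓ₀ := ⟨by linarith [hs.2], by linarith [hs.1]⟩
  have hac : AbsolutelyContinuousOnInterval y₀ 0 (-s) := by
    obtain ⟨K, hK⟩ := hy₀
    exact LipschitzIcc.absolutelyContinuous hs'.1 ⟨K, hK.mono (Icc_subset_Icc_right hs'.2)⟩
  rw [initialProfile, intervalIntegral.integral_sub hac.intervalIntegrable_deriv
    (intervalIntegrable_of_memLp_top hy₁ ⟨le_rfl, hs'.1.trans hs'.2⟩ hs'),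
    hac.integral_deriv_eq_sub]
  simp only [initialRight, clamp_of_mem hs']
  ring

theorem ae_hasDerivAt_initialRight (hℓ₀ : 0 < ℓ₀) (hy₀ : LipschitzIcc y₀ 0 ℓ₀)
    (hy₁ : MemLp y₁ ∞ (volume.restrict (Icc 0 ℓ₀))) :
    ∀ᵐ x, x ∈ Ioo 0 ℓ₀ →
      HasDerivAt (initialRight ℓ₀ y₀ y₁) ((y₁ x - deriv y₀ x) / 2) (-x) := by
  filter_upwards [hy₀.ae_differentiableAt, ae_hasDerivAt_primitive hℓ₀.le hy₁] with x h1 h2 hx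
  have h3 := (((h1 hx).hasDerivAt.sub_const (y₀ 0)).fun_sub (h2 hx)).div_const 2
  have h4 := hasDerivAt_comp_clamp hx h3
  rw [← neg_neg x] at h4
  have h5 := h4.comp (-x) (hasDerivAt_neg (-x))
  refine (h5.congr_deriv ?_)
  simp only [neg_neg]
  ring

end initialRight

/-- Every front profile comes with a profile travelling to the left. -/
theorem FrontProfile.exists_profile {κ : ℝ → ℝ} {T ℓ₀ S : ℝ} {y₀ y₁ f w : ℝ → ℝ} (hℓ₀ : 0 < ℓ₀)
    (hP : FrontProfile κ ℓ₀ S f w) (hy₀ : LipschitzIcc y₀ 0 ℓ₀) (hy₀ℓ : y₀ ℓ₀ = 0)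
    (hT : S + w S = T)
    (hf : ∀ᵐ x, x ∈ Ioo 0 ℓ₀ → HasDerivAt f ((y₁ x - deriv y₀ x) / 2) (-x)) :
    ∃ g, Profile κ T ℓ₀ y₀ y₁ S f g w := by
  obtain ⟨M, hM⟩ := hP.lipschitz_right
  obtain ⟨W, hW⟩ := hP.lipschitz_front
  obtain ⟨K, hK⟩ := hy₀.comp_clamp hℓ₀.le
  obtain ⟨μ, m1, m2, m3, m4⟩ := exists_inverse_id_add (w := fun s => 2 * w s)
    (hW.continuous.const_mul 2) (hP.monotone_front.const_mul zero_le_two)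
  have hμ0 : μ ℓ₀ = -ℓ₀ := by
    have := m2 (-ℓ₀)
    simp only [hP.front_start] at this
    rwa [show -ℓ₀ + 2 * ℓ₀ = ℓ₀ by ring] at this
  -- One formula for both regimes: for `η ≤ ℓ₀` the maximum is `-η` and the initial data result; at
  -- `η = s + 2 w s ≥ ℓ₀` the maximum is `s` and the first term is `y₀ ℓ₀ = 0`, leaving the
  -- reflection.
  refine ⟨fun η => y₀ (clamp 0 ℓ₀ η) - f (max (-η) (μ η)), hP,
    ⟨_, hK.sub (hM.comp (LipschitzWith.id.neg.max m3))⟩, hT, hf, ?_, ?_⟩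
  · intro x hx
    have h1 := m4 hx.2
    rw [hμ0] at h1
    simp only [clamp_of_mem hx, max_eq_left (show μ x ≤ -x by linarith [hx.2])]
  · intro s hs
    have h1 : ℓ₀ ≤ s + 2 * w s := by
      have := hP.monotone_front hs.1
      rw [hP.front_start] at this
      linarith [hs.1]
    have h2 : μ (s + 2 * w s) = s := m2 s
    simp only [clamp_of_ge hℓ₀.le h1, hy₀ℓ, h2]
    rw [max_eq_right (by linarith [hs.1])]
    ring

/-! ### Steering to the terminal data -/

theorem ae_sq_le_of_eLpNorm_sq_le {h : ℝ → ℝ} {s : Set ℝ} {B : ℝ} (hB : 0 ≤ B)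
    (hle : eLpNorm h ∞ (volume.restrict s) ^ 2 ≤ ENNReal.ofReal B) :
    ∀ᵐ x ∂(volume.restrict s), h x ^ 2 ≤ B := by
  filter_upwards [ae_le_eLpNormEssSup (f := h) (μ := volume.restrict s)] with x hx
  rw [← eLpNorm_exponent_top] at hx
  have h1 : ‖h x‖ₑ ^ 2 ≤ ENNReal.ofReal B := (pow_le_pow_left₀ zero_le hx 2).trans hle
  rw [Real.enorm_eq_ofReal_abs, ← ENNReal.ofReal_pow (abs_nonneg _), sq_abs,
    ENNReal.ofReal_le_ofReal_iff hB] at h1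
  exact h1

theorem LipschitzIcc.affine {g : ℝ → ℝ} {a b : ℝ} (hg : LipschitzIcc g a b) (m n : ℝ) :
    LipschitzIcc (fun x => m * g x + n) a b := by
  obtain ⟨K, hK⟩ := hg
  have h1 : LipschitzWith ‖m‖₊ fun x : ℝ => m * x + n := by
    apply LipschitzWith.of_dist_le_mul
    intro x y
    simp [Real.dist_eq, ← mul_sub, abs_mul]
  exact ⟨_, h1.comp_lipschitzOnWith hK⟩

theorem LipschitzIcc.add {g h : ℝ → ℝ} {a b : ℝ} (hg : LipschitzIcc g a b)
    (hh : LipschitzIcc h a b) : LipschitzIcc (fun x => g x + h x) a b := by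
  obtain ⟨K, hK⟩ := hg
  obtain ⟨L, hL⟩ := hh
  exact ⟨_, hK.add hL⟩

theorem LipschitzIcc.sub {g h : ℝ → ℝ} {a b : ℝ} (hg : LipschitzIcc g a b)
    (hh : LipschitzIcc h a b) : LipschitzIcc (fun x => g x - h x) a b := by
  obtain ⟨K, hK⟩ := hg
  obtain ⟨L, hL⟩ := hh
  exact ⟨_, hK.sub hL⟩

theorem flowRate_congr {κ f : ℝ → ℝ} {s x d : ℝ} (h : HasDerivAt f d s) :
    flowRate κ f s x = max (d ^ 2 / κ x - 1 / 2) 0 := by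
  rw [flowRate, h.deriv]

/-- A profile that pushes the front at a constant rate: the primitive of `√(κ(x) (v + 1/2))` along
the segment `x = x₀ + v σ`. -/
theorem exists_push {κ : ℝ → ℝ} {c₁ c₂ x₀ v S R : ℝ} (hc₁ : 0 < c₁)
    (hκ : ∀ x, 0 ≤ x → κ x ∈ Icc c₁ c₂) (hκL : LocallyLipschitzOn (Ici 0) κ) (hx₀ : 0 ≤ x₀)
    (hv : 0 ≤ v) (hS : 0 ≤ S) (hR : x₀ + v * S = R) :
    ∃ A : ℝ → ℝ, A 0 = 0 ∧ LipschitzIcc A 0 S ∧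
      ∀ᵐ s, s ∈ Ioo 0 S → ∃ d, HasDerivAt A d s ∧ max (d ^ 2 / κ (x₀ + v * s) - 1 / 2) 0 = v := by
  have hR0 : 0 ≤ R := hR ▸ by positivity
  set b : ℝ → ℝ := fun σ => Real.sqrt (κ (clamp 0 R (x₀ + v * σ)) * (v + 1 / 2)) with hb
  have hbc : Continuous b := by
    have h1 : Continuous fun σ : ℝ => κ (clamp 0 R (x₀ + v * σ)) :=
      (continuous_comp_clamp hκL hR0).comp (by fun_prop : Continuous fun σ : ℝ => x₀ + v * σ)
    exact (h1.mul continuous_const).sqrt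
  have hmem : MemLp b ∞ (volume.restrict (Icc 0 S)) := by
    apply memLp_top_of_bound hbc.aestronglyMeasurable (Real.sqrt (c₂ * (v + 1 / 2)))
    refine Filter.Eventually.of_forall fun σ => ?_
    rw [Real.norm_eq_abs, abs_of_nonneg (Real.sqrt_nonneg _)]
    apply Real.sqrt_le_sqrt
    exact mul_le_mul_of_nonneg_right (hκ _ (clamp_mem hR0 _).1).2 (by positivity)
  refine ⟨fun x => ∫ σ in (0 : ℝ)..x, b σ, by simp, lipschitzIcc_primitive hmem, ?_⟩
  filter_upwards [ae_hasDerivAt_primitive hS hmem] with s hs hsm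
  refine ⟨_, hs hsm, ?_⟩
  have h1 : x₀ + v * s ∈ Icc 0 R := by
    have := hsm.1.le
    refine ⟨by positivity, ?_⟩
    rw [← hR]
    have := mul_le_mul_of_nonneg_left hsm.2.le hv
    linarith
  have hk : 0 < κ (x₀ + v * s) := hc₁.trans_le (hκ _ h1.1).1
  simp only [hb, clamp_of_mem h1]
  rw [Real.sq_sqrt (by positivity), mul_div_cancel_left₀ _ hk.ne', max_eq_left (by linarith)]
  ring

/-- A front profile for which the front stops at `ℓbar` and the prescribed terminal data are
attained at time `T`. -/
theorem exists_steering_frontProfile {κ : ℝ → ℝ} {c₁ c₂ ℓ₀ T ℓbar : ℝ} {f₀ w₀ ybar₀ ybar₁ : ℝ → ℝ}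
    (hc₁ : 0 < c₁) (hκ : ∀ x, 0 ≤ x → κ x ∈ Icc c₁ c₂) (hκL : LocallyLipschitzOn (Ici 0) κ)
    (hℓ₀ : 0 < ℓ₀) (hw₀ : FrontProfile κ ℓ₀ 0 f₀ w₀) (hw₀c : ∀ s, 0 ≤ s → w₀ s = w₀ 0)
    (hf₀ : ∀ s, 0 ≤ s → f₀ s = 0) (hℓbar : 0 < ℓbar) (hle : w₀ 0 ≤ ℓbar) (hT : 2 * ℓbar < T)
    (hybar₀ : LipschitzIcc ybar₀ 0 ℓbar)
    (hybar₁ : MemLp ybar₁ ∞ (volume.restrict (Icc 0 ℓbar))) (hybarℓ : ybar₀ ℓbar = 0)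
    (hsize : ∀ᵐ x, x ∈ Icc 0 ℓbar → (ybar₁ x + deriv ybar₀ x) ^ 2 ≤ 2 * κ ℓbar) :
    ∃ f w : ℝ → ℝ, FrontProfile κ ℓ₀ (T - ℓbar) f w ∧ (∀ s, T - 2 * ℓbar ≤ s → w s = ℓbar) ∧
      (∀ s, s ≤ 0 → f s = f₀ s) ∧
      (∀ x ∈ Icc 0 ℓbar, f (T - x) - f (T - 2 * ℓbar + x) = ybar₀ x) ∧
      ∀ᵐ x, x ∈ Ioo 0 ℓbar → HasDerivAt f ((ybar₁ x - deriv ybar₀ x) / 2) (T - x) ∧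
        HasDerivAt f (-(ybar₁ x + deriv ybar₀ x) / 2) (T - 2 * ℓbar + x) := by
  set S₁ := T - 2 * ℓbar with hS₁
  have hS₁pos : 0 < S₁ := by linarith
  set v := (ℓbar - w₀ 0) / S₁ with hvdef
  have hv : 0 ≤ v := div_nonneg (by linarith) hS₁pos.le
  have hvS : w₀ 0 + v * S₁ = ℓbar := by
    rw [hvdef, div_mul_cancel₀ _ hS₁pos.ne']
    ring
  have hw₀0 : 0 ≤ w₀ 0 := by
    have := hw₀.monotone_front (show -ℓ₀ ≤ 0 by linarith)
    rw [hw₀.front_start] at this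
    linarith
  obtain ⟨A, hA0, hAL, hAd⟩ := exists_push hc₁ hκ hκL hw₀0 hv hS₁pos.le hvS
  set Y : ℝ → ℝ := fun x => ∫ σ in (0 : ℝ)..x, ybar₁ σ with hY
  have hYL : LipschitzIcc Y 0 ℓbar := lipschitzIcc_primitive hybar₁
  have hYd := ae_hasDerivAt_primitive hℓbar.le hybar₁
  have hY0 : Y 0 = 0 := by simp [hY]
  -- `B` will be the part of `f` seen at time `T` after reflection, `C` the part seen directly. The
  -- additive constants give `B 0 = 0` and `C ℓbar = 0`, so that the pieces fit together
  -- continuously.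
  set B : ℝ → ℝ := fun x => -(1 / 2) * (ybar₀ x + Y x) + 1 / 2 * ybar₀ 0 with hB
  set C : ℝ → ℝ := fun x => -(1 / 2) * (Y x - ybar₀ x) + 1 / 2 * Y ℓbar with hC
  have hBL : LipschitzIcc B 0 ℓbar := (hybar₀.add hYL).affine _ _
  have hCL : LipschitzIcc C 0 ℓbar := (hYL.sub hybar₀).affine _ _
  have hB0 : B 0 = 0 := by
    simp only [hB, hY0]
    ring
  have hCℓ : C ℓbar = 0 := by
    simp only [hC, hybarℓ]
    ring
  have hBC : ∀ᵐ x, x ∈ Ioo 0 ℓbar → HasDerivAt B (-(ybar₁ x + deriv ybar₀ x) / 2) x ∧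
      HasDerivAt C (-(ybar₁ x - deriv ybar₀ x) / 2) x := by
    filter_upwards [hybar₀.ae_differentiableAt, hYd] with x h1 h2 hx
    have h3 := (h1 hx).hasDerivAt
    have h4 := h2 hx
    exact ⟨(((h3.fun_add h4).const_mul _).add_const _).congr_deriv (by ring),
      (((h4.fun_sub h3).const_mul _).add_const _).congr_deriv (by ring)⟩
  obtain ⟨M, hM⟩ := hw₀.lipschitz_right
  obtain ⟨W, hW⟩ := hw₀.lipschitz_front
  obtain ⟨KA, hKA⟩ := hAL.comp_clamp hS₁pos.le
  obtain ⟨KB, hKB⟩ := hBL.comp_clamp hℓbar.le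
  obtain ⟨KC, hKC⟩ := hCL.comp_clamp hℓbar.le
  -- Each summand is frozen outside its own interval by a clamp, so the sum is globally Lipschitz
  -- and only one summand varies at a time.
  set f : ℝ → ℝ := fun s => f₀ s + A (clamp 0 S₁ s) + B (clamp 0 ℓbar (s - S₁)) +
    C (clamp 0 ℓbar (T - s)) with hf
  set w : ℝ → ℝ := fun s => w₀ s + v * clamp 0 S₁ s with hw
  have hfL : ∃ K : ℝ≥0, LipschitzWith K f :=
    ⟨_, ((hM.add hKA).add (hKB.comp (LipschitzWith.id.sub (LipschitzWith.const S₁)))).add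
      (hKC.comp ((LipschitzWith.const T).sub LipschitzWith.id))⟩
  have hwL : ∃ K : ℝ≥0, LipschitzWith K w := by
    have h1 : LipschitzWith ‖v‖₊ fun x : ℝ => v * x := by
      apply LipschitzWith.of_dist_le_mul
      intro x y
      simp [Real.dist_eq, ← mul_sub, abs_mul]
    exact ⟨_, hW.add (h1.comp (lipschitzWith_clamp 0 S₁))⟩
  have hwm : Monotone w := fun s t hst => add_le_add (hw₀.monotone_front hst)
    (mul_le_mul_of_nonneg_left (monotone_clamp 0 S₁ hst) hv)
  have f1 : ∀ s, s ≤ 0 → f s = f₀ s := by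
    intro s hs
    simp only [hf, clamp_of_le hS₁pos.le hs, hA0,
      clamp_of_le hℓbar.le (show s - S₁ ≤ 0 by linarith), hB0,
      clamp_of_ge hℓbar.le (show ℓbar ≤ T - s by linarith), hCℓ, add_zero]
  have f2 : ∀ s ∈ Icc 0 S₁, f s = A s := by
    intro s hs
    simp only [hf, hf₀ s hs.1, clamp_of_mem hs,
      clamp_of_le hℓbar.le (show s - S₁ ≤ 0 by linarith [hs.2]), hB0,
      clamp_of_ge hℓbar.le (show ℓbar ≤ T - s by linarith [hs.2]), hCℓ, add_zero, zero_add]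
  have f3 : ∀ s ∈ Icc S₁ (T - ℓbar), f s = A S₁ + B (s - S₁) := by
    intro s hs
    simp only [hf, hf₀ s (hS₁pos.le.trans hs.1), clamp_of_ge hS₁pos.le hs.1,
      clamp_of_mem (show s - S₁ ∈ Icc 0 ℓbar from ⟨by linarith [hs.1], by linarith [hs.2]⟩),
      clamp_of_ge hℓbar.le (show ℓbar ≤ T - s by linarith [hs.2]), hCℓ, add_zero, zero_add]
  have f4 : ∀ s ∈ Icc (T - ℓbar) T, f s = A S₁ + B ℓbar + C (T - s) := by
    intro s hs
    simp only [hf, hf₀ s (by linarith [hs.1]),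
      clamp_of_ge hS₁pos.le (show S₁ ≤ s by linarith [hs.1]),
      clamp_of_ge hℓbar.le (show ℓbar ≤ s - S₁ by linarith [hs.1]),
      clamp_of_mem (show T - s ∈ Icc 0 ℓbar from ⟨by linarith [hs.2], by linarith [hs.1]⟩),
      zero_add]
  have w1 : ∀ s, s ≤ 0 → w s = w₀ s := by
    intro s hs
    simp only [hw, clamp_of_le hS₁pos.le hs, mul_zero, add_zero]
  have w2 : ∀ s ∈ Icc 0 S₁, w s = w₀ 0 + v * s := by
    intro s hs
    simp only [hw, clamp_of_mem hs, hw₀c s hs.1]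
  have w3 : ∀ s, S₁ ≤ s → w s = ℓbar := by
    intro s hs
    simp only [hw, clamp_of_ge hS₁pos.le hs, hw₀c s (hS₁pos.le.trans hs), hvS]
  have hfB : ∀ x ∈ Ioo 0 ℓbar, ∀ d, HasDerivAt B d x → HasDerivAt f d (S₁ + x) := by
    intro x hx d hd
    have h1 : HasDerivAt (fun s => A S₁ + B (s - S₁)) d (S₁ + x) := by
      apply HasDerivAt.const_add
      apply HasDerivAt.comp_sub_const
      simpa using hd
    refine h1.congr_of_eventuallyEq ?_
    filter_upwards [Icc_mem_nhds (show S₁ < S₁ + x by linarith [hx.1])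
      (show S₁ + x < T - ℓbar by linarith [hx.2])] with s hs using f3 s hs
  have hfC : ∀ x ∈ Ioo 0 ℓbar, ∀ d, HasDerivAt C d x → HasDerivAt f (-d) (T - x) := by
    intro x hx d hd
    have h1 : HasDerivAt (fun s => A S₁ + B ℓbar + C (T - s)) (-d) (T - x) := by
      apply HasDerivAt.const_add
      apply HasDerivAt.comp_const_sub
      simpa using hd
    refine h1.congr_of_eventuallyEq ?_
    filter_upwards [Icc_mem_nhds (show T - ℓbar < T - x by linarith [hx.2])
      (show T - x < T by linarith [hx.1])] with s hs using f4 s hs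
  refine ⟨f, w, ⟨hfL, hwL, hwm, ?_, ?_, by linarith⟩, w3, f1, ?_, ?_⟩
  · rw [w1 _ (by linarith), hw₀.front_start]
  · have ha : ∀ᵐ x : ℝ, x ≠ 0 := by simp [ae_iff]
    have hb : ∀ᵐ x : ℝ, x ≠ S₁ := by simp [ae_iff]
    have hshift : ∀ᵐ s : ℝ, (s - S₁ ∈ Ioo 0 ℓbar →
        HasDerivAt B (-(ybar₁ (s - S₁) + deriv ybar₀ (s - S₁)) / 2) (s - S₁)) ∧
        (s - S₁ ∈ Icc 0 ℓbar → (ybar₁ (s - S₁) + deriv ybar₀ (s - S₁)) ^ 2 ≤ 2 * κ ℓbar) := by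
      have h1 : ∀ᵐ x : ℝ, (x ∈ Ioo 0 ℓbar →
        HasDerivAt B (-(ybar₁ x + deriv ybar₀ x) / 2) x) ∧
        (x ∈ Icc 0 ℓbar → (ybar₁ x + deriv ybar₀ x) ^ 2 ≤ 2 * κ ℓbar) := by
        filter_upwards [hBC, hsize] with x h1 h2 using ⟨fun hx => (h1 hx).1, h2⟩
      exact (measurePreserving_sub_right volume S₁).quasiMeasurePreserving.ae h1
    filter_upwards [ha, hb, hshift, hAd, hw₀.flow] with s h1 h2 ⟨h3, h4⟩ h5 h6 hs
    rcases lt_or_gt_of_ne h1 with hneg | hpos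
    · have e1 : f =ᶠ[nhds s] f₀ := by
        filter_upwards [Iio_mem_nhds hneg] with z hz using f1 z hz.le
      have e2 : w =ᶠ[nhds s] w₀ := by
        filter_upwards [Iio_mem_nhds hneg] with z hz using w1 z hz.le
      have e3 : flowRate κ f s (w s) = flowRate κ f₀ s (w₀ s) := by
        rw [flowRate, flowRate, e1.deriv_eq, w1 s hneg.le]
      rw [e3]
      exact (h6 ⟨hs.1, hneg⟩).congr_of_eventuallyEq e2
    rcases lt_or_gt_of_ne h2 with hlt | hgt
    · obtain ⟨d, h7, h8⟩ := h5 ⟨hpos, hlt⟩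
      have h9 : HasDerivAt f d s := by
        refine h7.congr_of_eventuallyEq ?_
        filter_upwards [Icc_mem_nhds hpos hlt] with z hz using f2 z hz
      rw [flowRate_congr h9, w2 s ⟨hpos.le, hlt.le⟩, h8]
      have h10 : HasDerivAt (fun s => w₀ 0 + v * s) v s := by
        simpa using ((hasDerivAt_id s).const_mul v).const_add (w₀ 0)
      refine h10.congr_of_eventuallyEq ?_
      filter_upwards [Icc_mem_nhds hpos hlt] with z hz using w2 z hz
    · have hm : s - S₁ ∈ Ioo 0 ℓbar := ⟨by linarith, by linarith [hs.2]⟩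
      have h7 := hfB _ hm _ (h3 hm)
      rw [add_sub_cancel] at h7
      have h8 := h4 (Ioo_subset_Icc_self hm)
      have hk : 0 < κ ℓbar := hc₁.trans_le (hκ _ hℓbar.le).1
      rw [flowRate_congr h7, w3 s hgt.le, max_eq_right]
      · refine (hasDerivAt_const s ℓbar).congr_of_eventuallyEq ?_
        filter_upwards [Ioi_mem_nhds hgt] with z hz using w3 z hz.le
      -- The size condition enters here: `((ybar₁ + ybar₀')/2)² ≤ κ ℓbar / 2`, so the flow rate
      -- vanishes.
      · rw [sub_nonpos, div_le_iff₀ hk]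
        linarith
  · intro x hx
    rw [f4 _ ⟨by linarith [hx.2], by linarith [hx.1]⟩,
      f3 _ ⟨by linarith [hx.1], by linarith [hx.2]⟩]
    simp only [hB, hC, sub_sub_cancel, add_sub_cancel_left, hybarℓ]
    ring
  · filter_upwards [hBC] with x h1 hx
    obtain ⟨h2, h3⟩ := h1 hx
    exact ⟨(hfC x hx _ h3).congr_deriv (by ring), hfB x hx _ h2⟩

end Debonding

end

/-! ### The controllability theorem -/

theorem mainTheorem3
    -- the toughness: locally Lipschitz on `[0, ∞)`, with values in `[c₁, c₂]`, `c₁ > 0`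
    (κ : ℝ → ℝ) (c₁ c₂ : ℝ) (hc₁ : 0 < c₁)
    (hκ : ∀ x, 0 ≤ x → κ x ∈ Set.Icc c₁ c₂) (hκL : LocallyLipschitzOn (Set.Ici 0) κ)
    -- the initial data
    (ℓ₀ : ℝ) (hℓ₀ : 0 < ℓ₀) (y₀ y₁ : ℝ → ℝ)
    (hy₀ : Debonding.LipschitzIcc y₀ 0 ℓ₀)
    (hy₁ : MemLp y₁ ∞ (volume.restrict (Set.Icc 0 ℓ₀)))
    (hy₀ℓ : y₀ ℓ₀ = 0)
    -- the final time and the final data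
    (T ℓbar : ℝ) (hℓbar : 0 < ℓbar) (ybar₀ ybar₁ : ℝ → ℝ)
    (hybar₀ : Debonding.LipschitzIcc ybar₀ 0 ℓbar)
    (hybar₁ : MemLp ybar₁ ∞ (volume.restrict (Set.Icc 0 ℓbar)))
    (hstar : Debonding.initialFront κ ℓ₀ y₀ y₁ ≤ ℓbar) (hT : 2 * ℓbar < T)
    (hybarℓ : ybar₀ ℓbar = 0)
    (hsize : eLpNorm (fun x => ybar₁ x + deriv ybar₀ x) ∞ (volume.restrict (Set.Icc 0 ℓbar)) ^ 2
      ≤ ENNReal.ofReal (2 * κ ℓbar)) :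
    ∃ u : ℝ → ℝ, Debonding.LipschitzIcc u 0 T ∧
      (∃ (ℓ : ℝ → ℝ) (y : ℝ → ℝ → ℝ), Debonding.IsSolution κ T ℓ₀ y₀ y₁ u ℓ y) ∧
      ∀ (ℓ : ℝ → ℝ) (y : ℝ → ℝ → ℝ), Debonding.IsSolution κ T ℓ₀ y₀ y₁ u ℓ y →
        ℓ T = ℓbar ∧
        (∀ x ∈ Set.Icc 0 ℓbar, y T x = ybar₀ x) ∧
        (∀ᵐ x ∂(volume.restrict (Set.Icc 0 ℓbar)),
          HasDerivWithinAt (fun t => y t x) (ybar₁ x) (Set.Icc 0 T) T) ∧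
        ∀ t ∈ Set.Icc (T - ℓbar) T, ℓ t = ℓbar := by
  open Debonding in
  have hκ₁ : ∀ x, 0 ≤ x → c₁ ≤ κ x := fun x hx => (hκ x hx).1
  have hkpos : 0 < κ ℓbar := hc₁.trans_le (hκ₁ _ hℓbar.le)
  have hsize' := ae_sq_le_of_eLpNorm_sq_le (by positivity) hsize
  rw [ae_restrict_iff' measurableSet_Icc] at hsize'
  have hf₀ := exists_lipschitzWith_initialRight hℓ₀ hy₀ hy₁
  obtain ⟨w₀, hw₀, hw₀c⟩ := exists_initial_frontProfile hc₁ hκ₁ hκL hℓ₀ hf₀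
  rw [hw₀.initialFront_eq hc₁ hκ₁ hκL hℓ₀ (initialRight_eqOn hy₀ hy₁)] at hstar
  obtain ⟨f, w, hP₀, hwbar, hff₀, hterm, hder⟩ := exists_steering_frontProfile hc₁ hκ hκL hℓ₀ hw₀
    hw₀c (fun s hs => initialRight_of_nonneg hℓ₀ hs) hℓbar hstar hT hybar₀ hybar₁ hybarℓ hsize'
  have hfd : ∀ᵐ x, x ∈ Ioo 0 ℓ₀ → HasDerivAt f ((y₁ x - deriv y₀ x) / 2) (-x) := by
    filter_upwards [ae_hasDerivAt_initialRight hℓ₀ hy₀ hy₁] with x h1 hx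
    refine (h1 hx).congr_of_eventuallyEq ?_
    filter_upwards [Iio_mem_nhds (show -x < 0 by linarith [hx.1])] with z hz using hff₀ z hz.le
  obtain ⟨g, hP⟩ := hP₀.exists_profile (T := T) (y₁ := y₁) hℓ₀ hy₀ hy₀ℓ
    (by rw [hwbar _ (by linarith)]; ring) hfd
  obtain ⟨M, hM⟩ := hP.lipschitz_right
  obtain ⟨N, hN⟩ := hP.lipschitz_left
  refine ⟨fun t => f t + g t, ⟨_, (hM.add hN).lipschitzOnWith⟩,
    hP.exists_solution hc₁ hκ₁ hℓ₀ hy₀, fun ℓ y hsol => ?_⟩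
  obtain ⟨hℓw, hy⟩ := hP.unique hc₁ hκ₁ hκL hℓ₀ hy₀ (fun t _ => rfl) hsol
  have hfinal : ∀ t ∈ Icc (T - ℓbar) T, ℓ t = ℓbar := by
    intro t ht
    have h1 := hℓw t ⟨by linarith [ht.1], ht.2⟩
    -- The front crosses `s = T - 2ℓbar` at time `T - ℓbar`, and crossing times increase with `s`.
    have h2 : T - 2 * ℓbar ≤ t - ℓ t := by
      rw [← hP.strictMono.le_iff_le, ← h1, hwbar _ le_rfl]
      linarith [ht.1]
    rw [h1, hwbar _ h2]
  have hg : ∀ s ∈ Icc (T - 2 * ℓbar) (T - ℓbar), g (s + 2 * ℓbar) = -f s := by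
    intro s hs
    have := hP.reflection s ⟨by linarith [hs.1], hs.2⟩
    rwa [hwbar s hs.1] at this
  -- Near time `T` the left-going wave is the reflection at the resting front; `T - x ≤ t` ensures
  -- that this reflection took place after the front had stopped.
  have hrep : ∀ t ∈ Icc (T - ℓbar) T, ∀ x ∈ Icc 0 ℓbar, T - x ≤ t →
      y t x = f (t - x) - f (t + x - 2 * ℓbar) := by
    intro t ht x hx htx
    have h1 := hg (t + x - 2 * ℓbar) ⟨by linarith, by linarith [ht.2, hx.2]⟩
    rw [sub_add_cancel] at h1
    rw [hy t x ⟨by simp only; linarith [ht.1], ht.2, hx.1, by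
      simp only
      rw [hfinal t ht]
      exact hx.2⟩, h1]
    ring
  have hTm : T ∈ Icc (T - ℓbar) T := ⟨by linarith, le_rfl⟩
  refine ⟨hfinal T hTm, fun x hx => ?_, ?_, hfinal⟩
  · rw [hrep T hTm x hx (by linarith [hx.1]), ← hterm x hx]
    congr 2
    ring
  · rw [ae_restrict_iff' measurableSet_Icc]
    have ha : ∀ᵐ x : ℝ, x ≠ 0 := by simp [ae_iff]
    have hb : ∀ᵐ x : ℝ, x ≠ ℓbar := by simp [ae_iff]
    filter_upwards [ha, hb, hder] with x h1 h2 h3 hx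
    have hxm : x ∈ Ioo 0 ℓbar := ⟨lt_of_le_of_ne hx.1 h1.symm, lt_of_le_of_ne hx.2 h2⟩
    obtain ⟨h4, h5⟩ := h3 hxm
    have h6 : HasDerivAt (fun t => f (t - x)) ((ybar₁ x - deriv ybar₀ x) / 2) T :=
      h4.comp_sub_const T x
    have h7 : HasDerivAt (fun t => f (t + x - 2 * ℓbar)) (-(ybar₁ x + deriv ybar₀ x) / 2) T := by
      have e : T - 2 * ℓbar + x = T + (x - 2 * ℓbar) := by ring
      rw [e] at h5
      simpa only [add_sub_assoc] using h5.comp_add_const T (x - 2 * ℓbar)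
    have h8 := ((h6.fun_sub h7).congr_deriv (show _ = ybar₁ x by ring)).hasDerivWithinAt
      (s := Icc 0 T)
    refine h8.congr_of_eventuallyEq ?_ (hrep T hTm x hx (by linarith [hx.1]))
    filter_upwards [self_mem_nhdsWithin,
      nhdsWithin_le_nhds (Ioi_mem_nhds (show T - x < T by linarith [hxm.1]))] with t ht htx
    have htx' : T - x < t := htx
    exact hrep t ⟨by linarith [hx.2], ht.2⟩ x hx htx'.le
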